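/- \textbf{Setting.} Consider a two-user discrete memoryless interference channel $P_{Y_1Y_2|X_1X_2}$ with finite output alphabets, and for $k=1,2$ a distribution $P_{W_kX_k}$ on $\mathbb Z_{q_{W_k}}\times\mathbb Z_{q_{X_k}}$, where $q_{W_k},q_{X_k}$ are primes. Let $N=2^n$, $\beta\in(0,1/2)$, $\delta_N=2^{-N^\beta}$, $K\ge 1$; let $\mathbf G_N=\mathbf B_N\mathbf F^{\otimes n}$, where $\mathbf F=\begin{bmatrix}1&0\\1&1\end{bmatrix}$ and $\mathbf B_N$ is the bit-reversal matrix. Under the target law $P$, $(W_1,X_1,W_2,X_2,Y_1,Y_2)^{1:N}$ are $N$ i.i.d. copies with law $P_{W_1X_1}P_{W_2X_2}P_{Y_1Y_2|X_1X_2}$; put $U_k'^{1:N}=W_k^{1:N}\mathbf G_N$ and $U_k^{1:N}=X_k^{1:N}\mathbf G_N$. Entropies are in bits and taken under $P$. For a symbol $A$ over an alphabet of size $q$ call $A$ \emph{high} given $B$ if $H(A|B)\ge\log_2 q-\delta_N$, and \emph{low} given $B$ if $H(A|B)\le\delta_N$. $\mathcal H_{W_k}$, $\mathcal L_{W_k|Y_k}$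 are the sets of $j\in[N]$ for which $U_k'^j$ is high given $U_k'^{1:j-1}$, respectively low given $(Y_k^{1:N},U_k'^{1:j-1})$; $\mathcal H_{X_k|W_k}$, $\mathcal H_{X_k|W_1W_2}$, $\mathcal L_{X_k|Y_kW_1W_2}$ are the sets of $j$ for which $U_k^j$ is high given $(U_k'^{1:N},U_k^{1:j-1})$, high given $(U_1'^{1:N},U_2'^{1:N},U_k^{1:j-1})$, low given $(Y_k^{1:N},U_1'^{1:N},U_2'^{1:N},U_k^{1:j-1})$, respectively. For a monotone chain rule expansion $S^{1:2N}$ of two of the sequences (an interleaving that keeps the order of each), $\mathcal H_{S_V}$, $\mathcal L_{S_V|Y_r}$ denote the sets of those $j$ for which the $j$-th symbol of the sequence $V$, standing at place $f(j)$ of $S$, is high given $S^{1:f(j)-1}$, low given $(Y_r^{1:N},S^{1:f(j)-1})$, and $\mathcal L_{S_V|Y_rW_r}$ the one where it is low given $(Y_r^{1:N},U_r'^{1:N},S^{1:f(j)-1})$. \textbf{Index partitions} (the roles of the users $1,2$ may be exchanged everywhere). \emph{Type A}: given expansions $S$ and $T$ of $(U_1',U_2')$, let $\mathcal C_k^1=\mathcal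 H_{S_{U_k'}}\cap\mathcal L_{S_{U_k'}|Y_1}$ and $\mathcal C_k^2=\mathcal H_{T_{U_k'}}\cap\mathcal L_{T_{U_k'}|Y_2}$; $\mathcal I_{kc}=\mathcal C_k^1\cap\mathcal C_k^2$, $\mathcal I_{kc}^1=\mathcal C_k^1\setminus\mathcal C_k^2$, and $\mathcal I_{kc}^2$ is any subset of $\mathcal C_k^2\setminus\mathcal C_k^1$ with $|\mathcal I_{kc}^2|=|\mathcal I_{kc}^1|$ (such subsets being assumed to exist). \emph{Type B}: given expansions $S$ of $(U_1,U_2')$ and $T$ of $(U_1',U_2')$, choose $\mathcal C_1^1\subseteq\mathcal H_{W_1}\cap\mathcal L_{W_1|Y_1}$, $\mathcal C_2^1\subseteq\mathcal H_{W_2}\cap\mathcal L_{S_{U_2'}|Y_1}$ and $\mathcal C_k^2\subseteq\mathcal H_{W_k}\cap\mathcal L_{T_{U_k'}|Y_2}$ with $|\mathcal C_k^1|=|\mathcal C_k^2|$ for $k=1,2$; $\mathcal I_{kc}=\mathcal C_k^1\cap\mathcal C_k^2$, $\mathcal I_{kc}^1=\mathcal C_k^1\setminus\mathcal C_k^2$,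 $\mathcal I_{kc}^2=\mathcal C_k^2\setminus\mathcal C_k^1$. In both types $\mathcal F'_{kr}=\mathcal H_{W_k}\setminus(\mathcal I_{kc}\cup\mathcal I_{kc}^1\cup\mathcal I_{kc}^2)$. For the private sequences, $\mathcal I_{kp}=\mathcal H\cap\mathcal L$ and $\mathcal F_{kr}=\mathcal H\setminus\mathcal L$ with $(\mathcal H,\mathcal L)=(\mathcal H_{X_k|W_1W_2},\mathcal L_{X_k|Y_kW_1W_2})$, except that $(\mathcal H,\mathcal L)=(\mathcal H_{X_1|W_1},\mathcal L_{S_{U_1}|Y_1W_1})$ for $k=1$ in Type B. \textbf{Encoding of $K$ chained blocks.} All message symbols, frozen symbols and the shared symbols below are independent and uniform. In every block, $u_k'^j$ is a message symbol for $j\in\mathcal I_{kc}$, and a frozen symbol (the same in all blocks) for $j\in\mathcal F'_{kr}$. On $\mathcal I_{kc}^1$ it is a message symbol, except in Block $K$, where it is a shared symbol; on $\mathcal I_{kc}^2$ it repeats, through a fixed bijection $\mathcal I_{kc}^1\to\mathcal I_{kc}^2$, the content of $\mathcal I_{kc}^1$ in the preceding block, except in Block 1, where it is a shared symbol. The remaining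 $u_k'^j$ are drawn from $P_{U_k'^j|U_k'^{1:j-1}}$. In every block $u_k^j$ is a message symbol for $j\in\mathcal I_{kp}$, a frozen symbol (the same in all blocks) for $j\in\mathcal F_{kr}$, and otherwise drawn from $P_{U_k^j|U_k'^{1:N}U_k^{1:j-1}}$. (Conditional laws given an event of $P$-probability $0$ are taken uniform.) Sender $k$ sends the $x_k^{1:N}$ with $x_k^{1:N}\mathbf G_N=u_k^{1:N}$ through the memoryless channel. \textbf{Decoding.} Receiver 1 decodes from Block 1 to Block $K$, Receiver 2 from Block $K$ to Block 1. In each block a receiver estimates symbols successively, each by a maximizer of its conditional probability under $P$ given the received block and the previous estimates on which the corresponding low set is conditioned; symbols outside the corresponding low set are known to it (they are frozen, shared, or delivered separately without error). However, after its first decoded block, Receiver 1 takes $\{u_k'^j\}_{j\in\mathcal I_{kc}^2}$ (Receiver 2: $\{u_k'^j\}_{j\in\mathcal I_{kc}^1}$) from its estimates for the previously decoded block, and the shared symbols in the last decoded block are known. A \emph{Type I} receiver $r$ (both receivers in Type A, Receiver 2 in Type B) first decodes $(U_1',U_2')$ jointly in the order of its expansion, with low sets $\mathcal L_{S_{U_k'}|Y_1}$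 for Receiver 1 and $\mathcal L_{T_{U_k'}|Y_2}$ for Receiver 2, and then $U_r$, with low set $\mathcal L_{X_r|Y_rW_1W_2}$. The \emph{Type II} receiver (Receiver 1 in Type B) first decodes $U_1'$, with low set $\mathcal L_{W_1|Y_1}$, and then $(U_1,U_2')$ jointly in the order of $S$, with low sets $\mathcal L_{S_{U_1}|Y_1W_1}$ and $\mathcal L_{S_{U_2'}|Y_1}$. The error probability of a receiver is the probability that its estimate of $(U_1'^{1:N},U_2'^{1:N},U_r^{1:N})$ is wrong in at least one of the $K$ blocks. \textbf{Claim.} With $\log$ the natural logarithm, the error probability of every Type I receiver satisfies $$P_e^{I}\le\frac{(K+1)(K+2)}{2}N\delta_N+2K(K+1)\sqrt{\log 2}\,\sqrt{N\delta_N},$$ and that of every Type II receiver satisfies $$P_e^{II}\le\frac{K(K+1)(K+5)}{6}N\delta_N+\frac{2K(K^2+6K-1)}{3}\sqrt{\log 2}\,\sqrt{N\delta_N}.$$ -/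

import Mathlib

open scoped Matrix

namespace PolarIC

/-! ### Finite probability, entropy in bits, maximum a posteriori estimates -/

section Probability

variable {Ω α γ : Type*} [Fintype Ω]

open Classical in
/-- Probability of the event `E` under the mass function `μ`. -/
noncomputable def prob (μ : Ω → ℝ) (E : Ω → Prop) : ℝ := ∑ ω, if E ω then μ ω else 0

open Classical in
/-- The conditional probability `P(f = a | g = c)`. If `P(g = c) = 0`, where it is not determined by
the joint law, it is taken to be uniform, so that `condLaw μ f g c` is always a distribution. -/
noncomputable def condLaw [Fintype α] (μ : Ω → ℝ) (f : Ω → α) (g : Ω → γ) (c : γ) (a : α) : ℝ :=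
  if prob μ (fun ω => g ω = c) = 0 then 1 / (Fintype.card α : ℝ)
  else prob μ (fun ω => f ω = a ∧ g ω = c) / prob μ (fun ω => g ω = c)

/-- The conditional Shannon entropy `H(f | g)` in bits. -/
noncomputable def condEnt [Fintype α] (μ : Ω → ℝ) (f : Ω → α) (g : Ω → γ) : ℝ :=
  -∑ ω, μ ω * Real.logb 2 (condLaw μ f g (g ω) (f ω))

/-- A maximizer of a real function on a nonempty finite type. -/
noncomputable def argmax {α : Type*} [Finite α] [Nonempty α] (h : α → ℝ) : α :=
  (Finite.exists_max h).choose

/-- The maximum a posteriori estimate of `f` from the observation `g = c`. -/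
noncomputable def mapEst [Fintype α] [Nonempty α] (μ : Ω → ℝ) (f : Ω → α) (g : Ω → γ) (c : γ) : α :=
  argmax (condLaw μ f g c)

end Probability

/-! ### The polar transform -/

/-- The position whose binary expansion (`n` bits) is the reversed one. -/
def bitRev (n : ℕ) : Equiv.Perm (Fin (2 ^ n)) :=
  finFunctionFinEquiv.symm.trans ((Equiv.arrowCongr Fin.revPerm (Equiv.refl _)).trans
    finFunctionFinEquiv)

/-- The `n`-fold Kronecker power of the kernel `[1 0; 1 1]`, its rows and columns being indexed
through the binary expansions of the positions. -/
def kernelPow (n : ℕ) (R : Type*) [CommRing R] : Matrix (Fin (2 ^ n)) (Fin (2 ^ n)) R :=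
  Matrix.of fun i j => ∏ k : Fin n,
    (!![1, 0; 1, 1] : Matrix (Fin 2) (Fin 2) R)
      (finFunctionFinEquiv.symm i k) (finFunctionFinEquiv.symm j k)

/-- The generator matrix `G_N = B_N F^{⊗n}`, `N = 2 ^ n`. -/
def polarMatrix (n : ℕ) (R : Type*) [CommRing R] : Matrix (Fin (2 ^ n)) (Fin (2 ^ n)) R :=
  (bitRev n).permMatrix R * kernelPow n R

/-! ### Sequences, channel, target distribution -/

/-- The four symbol sequences of a block: for each sender a common one and a private one. -/
abbrev Stream := Fin 2 ⊕ Fin 2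

/-- The common sequence of sender `k` (the letters `W_k`, transformed: `U'_k`). -/
abbrev com (k : Fin 2) : Stream := Sum.inl k

/-- The private sequence of sender `k` (the letters `X_k`, transformed: `U_k`). -/
abbrev priv (k : Fin 2) : Stream := Sum.inr k

/-- The other sender (or receiver). -/
abbrev other (a : Fin 2) : Fin 2 := a + 1

variable {q : Stream → ℕ} [∀ s, Fact (q s).Prime] {Y : Fin 2 → Type*} [∀ r, Fintype (Y r)]

/-- A two-user discrete memoryless interference channel with input distributions: `input k` is
`P_{W_k X_k}` and `chan` is `P_{Y_1 Y_2 | X_1 X_2}`. The alphabets are `W_k = ZMod (q (com k))` and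
`X_k = ZMod (q (priv k))`. -/
structure Model (q : Stream → ℕ) [∀ s, Fact (q s).Prime]
    (Y : Fin 2 → Type*) [∀ r, Fintype (Y r)] where
  input : ∀ k, ZMod (q (com k)) × ZMod (q (priv k)) → ℝ
  input_mem : ∀ k, input k ∈ stdSimplex ℝ (ZMod (q (com k)) × ZMod (q (priv k)))
  chan : (∀ k, ZMod (q (priv k))) → (∀ r, Y r) → ℝ
  chan_mem : ∀ x, chan x ∈ stdSimplex ℝ (∀ r, Y r)

/-- The letters of one channel use: `W_1, W_2, X_1, X_2` and `Y_1, Y_2`. -/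
abbrev Letter (q : Stream → ℕ) (Y : Fin 2 → Type*) := (∀ s, ZMod (q s)) × (∀ r, Y r)

/-- The letters of a block of `2 ^ n` channel uses. -/
abbrev Block (q : Stream → ℕ) (Y : Fin 2 → Type*) (n : ℕ) := Fin (2 ^ n) → Letter q Y

/-- The target distribution `P` of a block: independent and identically distributed letters with
law `P_{W_1 X_1} P_{W_2 X_2} P_{Y_1 Y_2 | X_1 X_2}`. -/
noncomputable def Model.target (M : Model q Y) (n : ℕ) (b : Block q Y n) : ℝ :=
  ∏ t, (∏ k, M.input k ((b t).1 (com k), (b t).1 (priv k))) *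
    M.chan (fun k => (b t).1 (priv k)) (b t).2

/-- The symbols of the transformed sequences: `U'_k = W_k G_N` for `s = com k` and `U_k = X_k G_N`
for `s = priv k`. -/
def sym {n : ℕ} (s : Stream) (j : Fin (2 ^ n)) (b : Block q Y n) : ZMod (q s) :=
  ((fun t => (b t).1 s) ᵥ* polarMatrix n (ZMod (q s))) j

/-- A whole transformed sequence. -/
def whole {n : ℕ} (s : Stream) (b : Block q Y n) : Fin (2 ^ n) → ZMod (q s) := fun j => sym s j b

/-- The symbols of a transformed sequence before position `j`. -/
def past {n : ℕ} (s : Stream) (j : Fin (2 ^ n)) (b : Block q Y n) :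
    {i : Fin (2 ^ n) // i < j} → ZMod (q s) := fun i => sym s i.1 b

/-- The output sequence at receiver `r`. -/
def out {n : ℕ} (r : Fin 2) (b : Block q Y n) : Fin (2 ^ n) → Y r := fun t => (b t).2 r

/-- A monotone chain rule expansion of two sequences of length `N = 2 ^ n`: the symbol `j` of
sequence `k` is put at place `pos (k, j)` among `2 N`, and the order in each sequence is kept. -/
structure Expansion (n : ℕ) where
  pos : Fin 2 × Fin (2 ^ n) ≃ Fin (2 * 2 ^ n)
  mono : ∀ k, StrictMono fun j => pos (k, j)

/-- The part of the expansion of the sequences `st 0`, `st 1` before the place of the symbol `c`. -/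
def Expansion.past {n : ℕ} (E : Expansion n) (st : Fin 2 → Stream) (c : Fin 2 × Fin (2 ^ n))
    (b : Block q Y n) (c' : {c' // E.pos c' < E.pos c}) : ZMod (q (st c'.1.1)) :=
  sym (st c'.1.1) c'.1.2 b

/-! ### Polarized index sets -/

/-- `δ_N = 2 ^ (-N ^ β)` for `N = 2 ^ n`. -/
noncomputable def delta (n : ℕ) (β : ℝ) : ℝ := (2 : ℝ) ^ (-((2 ^ n : ℕ) : ℝ) ^ β)

section IndexSets

variable (M : Model q Y) (n : ℕ) (β : ℝ)

/-- `H_{W_k}`. -/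
noncomputable def highW (k : Fin 2) : Set (Fin (2 ^ n)) :=
  {j | Real.logb 2 (q (com k)) - delta n β ≤
    condEnt (M.target n) (sym (com k) j) (past (com k) j)}

/-- `L_{W_k | Y_k}`. -/
noncomputable def lowW (k : Fin 2) : Set (Fin (2 ^ n)) :=
  {j | condEnt (M.target n) (sym (com k) j) (fun b => (out k b, past (com k) j b)) ≤ delta n β}

/-- `H_{S_{U_k}}` for the expansion `E` of the sequences `st 0`, `st 1`. -/
noncomputable def highS (E : Expansion n) (st : Fin 2 → Stream) (k : Fin 2) :
    Set (Fin (2 ^ n)) :=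
  {j | Real.logb 2 (q (st k)) - delta n β ≤
    condEnt (M.target n) (sym (st k) j) (E.past st (k, j))}

/-- `L_{S_{U_k} | Y_r}` for the expansion `E` of the sequences `st 0`, `st 1`. -/
noncomputable def lowS (E : Expansion n) (st : Fin 2 → Stream) (r k : Fin 2) :
    Set (Fin (2 ^ n)) :=
  {j | condEnt (M.target n) (sym (st k) j) (fun b => (out r b, E.past st (k, j) b)) ≤ delta n β}

/-- `H_{X_k | W_k}`. -/
noncomputable def highX (k : Fin 2) : Set (Fin (2 ^ n)) :=
  {j | Real.logb 2 (q (priv k)) - delta n β ≤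
    condEnt (M.target n) (sym (priv k) j) (fun b => (whole (com k) b, past (priv k) j b))}

/-- `H_{X_k | W_1 W_2}`. -/
noncomputable def highXWW (k : Fin 2) : Set (Fin (2 ^ n)) :=
  {j | Real.logb 2 (q (priv k)) - delta n β ≤
    condEnt (M.target n) (sym (priv k) j)
      (fun b => (fun l : Fin 2 => whole (com l) b, past (priv k) j b))}

/-- `L_{X_k | Y_k W_1 W_2}`. -/
noncomputable def lowXWW (k : Fin 2) : Set (Fin (2 ^ n)) :=
  {j | condEnt (M.target n) (sym (priv k) j)
      (fun b => (out k b, fun l : Fin 2 => whole (com l) b, past (priv k) j b)) ≤ delta n β}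

/-- The two sequences which a Type II receiver `a` decodes jointly: its private sequence and the
common sequence of the other sender. -/
abbrev pairII (a : Fin 2) : Fin 2 → Stream
  | 0 => priv a
  | 1 => com (other a)

/-- `L_{S_{U_a} | Y_a W_a}` for the expansion `E` of the private sequence of sender `a` and the
common sequence of the other sender. -/
noncomputable def lowSW (E : Expansion n) (a : Fin 2) : Set (Fin (2 ^ n)) :=
  {j | condEnt (M.target n) (sym (priv a) j)
      (fun b => (out a b, whole (com a) b, E.past (pairII a) (0, j) b)) ≤ delta n β}

end IndexSets

/-! ### Encoding of `K` chained blocks -/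

/-- The partition of the indices used by the encoders. Common sequence of sender `k`: information
indices `I k`; chaining indices `I1 k` and `I2 k`; frozen indices `F k`; all others are almost
deterministic. Private sequence of sender `k`: information indices `Ip k`, frozen indices `Fp k`, all
others almost deterministic. The content of `j ∈ I1 k` is repeated at `link k j ∈ I2 k` in the next
block. -/
structure Layout (n : ℕ) where
  I : Fin 2 → Set (Fin (2 ^ n))
  I1 : Fin 2 → Set (Fin (2 ^ n))
  I2 : Fin 2 → Set (Fin (2 ^ n))
  F : Fin 2 → Set (Fin (2 ^ n))
  Ip : Fin 2 → Set (Fin (2 ^ n))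
  Fp : Fin 2 → Set (Fin (2 ^ n))
  link : Fin 2 → Equiv.Perm (Fin (2 ^ n))

/-- The independent uniform symbols which the encoders consume. Only the coordinates in the index
sets that they serve are ever used. -/
structure Seeds (q : Stream → ℕ) (n K : ℕ) where
  /-- frozen symbols, the same in all blocks -/
  frozen : ∀ s, Fin (2 ^ n) → ZMod (q s)
  /-- symbols put on the indices `I1` of the last block -/
  last : ∀ k, Fin (2 ^ n) → ZMod (q (com k))
  /-- symbols put on the indices `I2` of the first block -/
  first : ∀ k, Fin (2 ^ n) → ZMod (q (com k))
  /-- message symbols of each block -/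
  msg : Fin K → ∀ s, Fin (2 ^ n) → ZMod (q s)

/-- Seeds as a product. -/
def seedsEquiv (q : Stream → ℕ) (n K : ℕ) :
    ((∀ s, Fin (2 ^ n) → ZMod (q s)) × (∀ k, Fin (2 ^ n) → ZMod (q (com k))) ×
      (∀ k, Fin (2 ^ n) → ZMod (q (com k))) × (Fin K → ∀ s, Fin (2 ^ n) → ZMod (q s))) ≃
    Seeds q n K where
  toFun p := ⟨p.1, p.2.1, p.2.2.1, p.2.2.2⟩
  invFun s := (s.frozen, s.last, s.first, s.msg)
  left_inv _ := rfl
  right_inv _ := rfl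

noncomputable instance (n K : ℕ) : Fintype (Seeds q n K) := Fintype.ofEquiv _ (seedsEquiv q n K)

/-- The transformed sequences `U'_1, U'_2, U_1, U_2` in the `K` blocks. -/
abbrev Words (q : Stream → ℕ) (n K : ℕ) := Fin K → ∀ s, Fin (2 ^ n) → ZMod (q s)

/-- The channel outputs in the `K` blocks. -/
abbrev Outs (Y : Fin 2 → Type*) (n K : ℕ) := Fin K → Fin (2 ^ n) → ∀ r, Y r

/-- An outcome of the transmission of `K` blocks. -/
abbrev Run (q : Stream → ℕ) (Y : Fin 2 → Type*) (n K : ℕ) := Seeds q n K × Words q n K × Outs Y n K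

section Encoding

variable (M : Model q Y) {n K : ℕ} (c : Layout n)

open Classical in
/-- The value which the encoder assigns to the symbol `j` of the common sequence of sender `k` in
block `i`; `none` if that symbol is almost deterministic. -/
noncomputable def comValue (z : Seeds q n K) (u : Words q n K) (i : Fin K) (k : Fin 2)
    (j : Fin (2 ^ n)) : Option (ZMod (q (com k))) :=
  if j ∈ c.I k then some (z.msg i (com k) j)
  else if j ∈ c.I1 k then
    if i.val + 1 = K then some (z.last k j) else some (z.msg i (com k) j)
  else if j ∈ c.I2 k then
    if i.val = 0 then some (z.first k j)
    else some (u ⟨i.val - 1, (Nat.sub_le _ _).trans_lt i.isLt⟩ (com k) ((c.link k).symm j))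
  else if j ∈ c.F k then some (z.frozen (com k) j)
  else none

open Classical in
/-- The same for the private sequence of sender `k`. -/
noncomputable def privValue (z : Seeds q n K) (i : Fin K) (k : Fin 2) (j : Fin (2 ^ n)) :
    Option (ZMod (q (priv k))) :=
  if j ∈ c.Ip k then some (z.msg i (priv k) j)
  else if j ∈ c.Fp k then some (z.frozen (priv k) j)
  else none

/-- Conditional probability with which the symbol `j` of the common sequence of sender `k` in block
`i` takes the value it has in `u`. Almost deterministic symbols are drawn from the target law given
the previous symbols. -/
noncomputable def comFactor (z : Seeds q n K) (u : Words q n K) (i : Fin K) (k : Fin 2)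
    (j : Fin (2 ^ n)) : ℝ :=
  match comValue c z u i k j with
  | some v => if u i (com k) j = v then 1 else 0
  | none => condLaw (M.target n) (sym (com k) j) (past (com k) j)
      (fun l => u i (com k) l.1) (u i (com k) j)

/-- The same for the private sequence. Almost deterministic symbols are drawn from the target law
given the common sequence of that sender and the previous symbols. -/
noncomputable def privFactor (z : Seeds q n K) (u : Words q n K) (i : Fin K) (k : Fin 2)
    (j : Fin (2 ^ n)) : ℝ :=
  match privValue c z i k j with
  | some v => if u i (priv k) j = v then 1 else 0
  | none => condLaw (M.target n) (sym (priv k) j)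
      (fun b => (whole (com k) b, past (priv k) j b))
      (u i (com k), fun l => u i (priv k) l.1) (u i (priv k) j)

/-- The channel input of sender `k` in block `i`: the sequence `X_k` with `X_k G_N = U_k`. -/
noncomputable def codeword (u : Words q n K) (i : Fin K) (k : Fin 2) :
    Fin (2 ^ n) → ZMod (q (priv k)) :=
  u i (priv k) ᵥ* (polarMatrix n (ZMod (q (priv k))))⁻¹

/-- The law of the transmission of `K` blocks: uniform seeds, encoding, memoryless channel. -/
noncomputable def runLaw (ω : Run q Y n K) : ℝ :=
  1 / (Fintype.card (Seeds q n K) : ℝ) *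
    ∏ i, (∏ k, (∏ j, comFactor M c ω.1 ω.2.1 i k j) * ∏ j, privFactor M c ω.1 ω.2.1 i k j) *
      ∏ t, M.chan (fun k => codeword ω.2.1 i k t) (ω.2.2 i t)

end Encoding

/-! ### Decoding -/

/-- Successive computation: the value at `i` is computed from the values at the indices of smaller
order. -/
def successive {ι : Type*} {A : ι → Type*} (ord : ι → ℕ)
    (rule : ∀ i, (∀ i', ord i' < ord i → A i') → A i) (i : ι) : A i :=
  rule i (fun i' _ => successive ord rule i')
termination_by ord i

/-- Decoding from the first block to the last one; `blk i prev` decodes block `i`, where `prev` is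
the result for block `i - 1` (`none` for the first block). -/
def forward {K : ℕ} {Est : Type*} (blk : Fin K → Option Est → Est) : Fin K → Est :=
  successive (fun i => i.val) fun i hist => blk i
    (if h : i.val = 0 then none
     else some (hist ⟨i.val - 1, (Nat.sub_le _ _).trans_lt i.isLt⟩ (Nat.sub_one_lt h)))

/-- Decoding from the last block to the first one; `blk i prev` decodes block `i`, where `prev` is
the result for block `i + 1` (`none` for the last block). -/
def backward {K : ℕ} {Est : Type*} (blk : Fin K → Option Est → Est) : Fin K → Est :=
  successive (fun i => K - i.val) fun i hist => blk i
    (if h : i.val + 1 < K then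
      some (hist ⟨i.val + 1, h⟩ (Nat.sub_lt_sub_left i.isLt (Nat.lt_succ_self _)))
     else none)

section Decoding

variable (M : Model q Y) {n K : ℕ} (c : Layout n)

open Classical in
/-- What a receiver decoding from block 1 to block `K` takes as the symbol `j` of the common sequence
of sender `k` in block `i` without estimating it: chained symbols come from its result `prev` for
block `i - 1`, chaining symbols of the last block are shared, and the symbols outside `L` are known
(frozen, or transmitted separately). `none` if the symbol has to be estimated. -/
noncomputable def knownFwd (ω : Run q Y n K) (L : Set (Fin (2 ^ n))) (i : Fin K) (k : Fin 2)
    (prev : Option (Fin (2 ^ n) → ZMod (q (com k)))) (j : Fin (2 ^ n)) :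
    Option (ZMod (q (com k))) :=
  if j ∈ c.I2 k ∧ prev.isSome then prev.map fun e => e ((c.link k).symm j)
  else if j ∈ c.I1 k ∧ i.val + 1 = K then some (ω.1.last k j)
  else if j ∈ L then none
  else some (ω.2.1 i (com k) j)

open Classical in
/-- The same for a receiver decoding from block `K` to block 1; `prev` is its result for block
`i + 1`. -/
noncomputable def knownBwd (ω : Run q Y n K) (L : Set (Fin (2 ^ n))) (i : Fin K) (k : Fin 2)
    (prev : Option (Fin (2 ^ n) → ZMod (q (com k)))) (j : Fin (2 ^ n)) :
    Option (ZMod (q (com k))) :=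
  if j ∈ c.I1 k ∧ prev.isSome then prev.map fun e => e (c.link k j)
  else if j ∈ c.I2 k ∧ i.val = 0 then some (ω.1.first k j)
  else if j ∈ L then none
  else some (ω.2.1 i (com k) j)

/-- Estimates of a Type I receiver for one block: both common sequences and its private one. -/
abbrev EstI (q : Stream → ℕ) (n : ℕ) (r : Fin 2) :=
  (∀ k, Fin (2 ^ n) → ZMod (q (com k))) × (Fin (2 ^ n) → ZMod (q (priv r)))

/-- First stage of the Type I decoder of receiver `r`: joint successive cancellation decoding of
the two common sequences in the order of the expansion `E`. -/
noncomputable def commonI (E : Expansion n) (r : Fin 2) (y : Fin (2 ^ n) → Y r)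
    (known : ∀ k, Fin (2 ^ n) → Option (ZMod (q (com k)))) :
    ∀ d : Fin 2 × Fin (2 ^ n), ZMod (q (com d.1)) :=
  successive (fun d => (E.pos d).val) fun d hist =>
    (known d.1 d.2).getD
      (mapEst (M.target n) (sym (com d.1) d.2) (fun b => (out r b, E.past com d b))
        (y, fun d' => hist d'.1 d'.2))

open Classical in
/-- Second stage of the Type I decoder of receiver `r`: successive cancellation decoding of the
private sequence, given the estimates `w` of the common ones. The symbols `x j` outside
`L_{X_r | Y_r W_1 W_2}` are known. -/
noncomputable def privateI (β : ℝ) (r : Fin 2) (y : Fin (2 ^ n) → Y r)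
    (w : ∀ k, Fin (2 ^ n) → ZMod (q (com k))) (x : Fin (2 ^ n) → ZMod (q (priv r))) :
    Fin (2 ^ n) → ZMod (q (priv r)) :=
  successive (fun j => j.val) fun j hist =>
    if j ∈ lowXWW M n β r then
      mapEst (M.target n) (sym (priv r) j)
        (fun b => (out r b, fun l : Fin 2 => whole (com l) b, past (priv r) j b))
        (y, w, fun i => hist i.1 i.2)
    else x j

/-- The Type I decoder of receiver `r` for block `i`, given the `known` common symbols. -/
noncomputable def blockI (β : ℝ) (E : Expansion n) (r : Fin 2) (ω : Run q Y n K) (i : Fin K)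
    (known : ∀ k, Fin (2 ^ n) → Option (ZMod (q (com k)))) : EstI q n r :=
  let y : Fin (2 ^ n) → Y r := fun t => ω.2.2 i t r
  let w : ∀ k, Fin (2 ^ n) → ZMod (q (com k)) := fun k j => commonI M E r y known (k, j)
  (w, privateI M β r y w (ω.2.1 i (priv r)))

/-- The Type I decoder of receiver `r`, from block 1 to block `K`. -/
noncomputable def decodeIFwd (β : ℝ) (E : Expansion n) (r : Fin 2) (ω : Run q Y n K) :
    Fin K → EstI q n r :=
  forward fun i prev => blockI M β E r ω i fun k =>
    knownFwd c ω (lowS M n β E com r k) i k (prev.map fun e => e.1 k)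

/-- The Type I decoder of receiver `r`, from block `K` to block 1. -/
noncomputable def decodeIBwd (β : ℝ) (E : Expansion n) (r : Fin 2) (ω : Run q Y n K) :
    Fin K → EstI q n r :=
  backward fun i prev => blockI M β E r ω i fun k =>
    knownBwd c ω (lowS M n β E com r k) i k (prev.map fun e => e.1 k)

/-- The estimates of receiver `r` are wrong in some block. -/
def ErrorI (r : Fin 2) (ω : Run q Y n K) (est : Fin K → EstI q n r) : Prop :=
  ∃ i, est i ≠ (fun k => ω.2.1 i (com k), ω.2.1 i (priv r))

/-- Estimates of a Type II receiver `a` for one block: the common sequence of sender `a`, and then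
the private sequence of sender `a` with the common sequence of the other sender. -/
abbrev EstII (q : Stream → ℕ) (n : ℕ) (a : Fin 2) :=
  (Fin (2 ^ n) → ZMod (q (com a))) × (∀ d : Fin 2 × Fin (2 ^ n), ZMod (q (pairII a d.1)))

/-- First stage of the Type II decoder of receiver `a`: successive cancellation decoding of the
common sequence of sender `a`. -/
noncomputable def commonII (a : Fin 2) (y : Fin (2 ^ n) → Y a)
    (known : Fin (2 ^ n) → Option (ZMod (q (com a)))) : Fin (2 ^ n) → ZMod (q (com a)) :=
  successive (fun j => j.val) fun j hist =>
    (known j).getD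
      (mapEst (M.target n) (sym (com a) j) (fun b => (out a b, past (com a) j b))
        (y, fun i => hist i.1 i.2))

open Classical in
/-- Second stage of the Type II decoder of receiver `a`: joint successive cancellation decoding of
its private sequence and the other common sequence in the order of the expansion `E`, given the
estimate `w` of the common sequence of sender `a`. The private symbols `x j` outside
`L_{S_{U_a} | Y_a W_a}` are known. -/
noncomputable def jointII (β : ℝ) (E : Expansion n) (a : Fin 2) (y : Fin (2 ^ n) → Y a)
    (w : Fin (2 ^ n) → ZMod (q (com a))) (x : Fin (2 ^ n) → ZMod (q (priv a)))
    (known : Fin (2 ^ n) → Option (ZMod (q (com (other a))))) :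
    ∀ d : Fin 2 × Fin (2 ^ n), ZMod (q (pairII a d.1)) :=
  successive (fun d => (E.pos d).val) fun d =>
    match d with
    | (0, j) => fun hist =>
      if j ∈ lowSW M n β E a then
        mapEst (M.target n) (sym (priv a) j)
          (fun b => (out a b, whole (com a) b, E.past (pairII a) (0, j) b))
          (y, w, fun d' => hist d'.1 d'.2)
      else x j
    | (1, j) => fun hist =>
      (known j).getD
        (mapEst (M.target n) (sym (com (other a)) j)
          (fun b => (out a b, E.past (pairII a) (1, j) b))
          (y, fun d' => hist d'.1 d'.2))

/-- The Type II decoder of receiver `a`, from block 1 to block `K`. -/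
noncomputable def decodeII (β : ℝ) (E : Expansion n) (a : Fin 2) (ω : Run q Y n K) :
    Fin K → EstII q n a :=
  forward fun i prev =>
    let y : Fin (2 ^ n) → Y a := fun t => ω.2.2 i t a
    let w := commonII M a y
      (knownFwd c ω (lowW M n β a) i a (prev.map fun e => e.1))
    (w, jointII M β E a y w (ω.2.1 i (priv a))
      (knownFwd c ω (lowS M n β E (pairII a) a 1) i (other a)
        (prev.map fun e j => e.2 (1, j))))

/-- The estimates of the Type II receiver `a` are wrong in some block. -/
def ErrorII (a : Fin 2) (ω : Run q Y n K) (est : Fin K → EstII q n a) : Prop :=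
  ∃ i, est i ≠ (ω.2.1 i (com a), fun d : Fin 2 × Fin (2 ^ n) => ω.2.1 i (pairII a d.1) d.2)

end Decoding

/-! ### The two schemes -/

section Schemes

variable (M : Model q Y) (n : ℕ) (β : ℝ)

/-- `C_k^r = H_{S_{U'_k}} ∩ L_{S_{U'_k} | Y_r}`, with the expansion `E` used at receiver `r`. -/
noncomputable def infoA (E : Expansion n) (r k : Fin 2) : Set (Fin (2 ^ n)) :=
  highS M n β E com k ∩ lowS M n β E com r k

/-- A Type A scheme: both receivers use Type I decoding, receiver `lead` (whose sets `C_k^lead` fix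
the common rates) from block 1 to block `K`, the other one from block `K` to block 1. -/
structure SchemeA where
  lead : Fin 2
  /-- the expansion of the two common sequences used at each receiver -/
  path : Fin 2 → Expansion n
  /-- the chosen subset of `C_k^{other} \ C_k^{lead}` -/
  sel : Fin 2 → Set (Fin (2 ^ n))
  sel_subset : ∀ k, sel k ⊆ infoA M n β (path (other lead)) (other lead) k \
    infoA M n β (path lead) lead k
  link : Fin 2 → Equiv.Perm (Fin (2 ^ n))
  /-- `link k` restricts to a bijection of `C_k^{lead} \ C_k^{other}` onto the chosen subset -/
  link_image : ∀ k, link k '' (infoA M n β (path lead) lead k \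
    infoA M n β (path (other lead)) (other lead) k) = sel k

/-- The index sets of a Type B scheme from which the common information indices of sender `k` for
the Type II receiver `a` are chosen: `H_{W_a} ∩ L_{W_a | Y_a}` for `k = a`, and
`H_{W_k} ∩ L_{S_{U'_k} | Y_a}` for the other sender. -/
noncomputable def candII (S : Expansion n) (a k : Fin 2) : Set (Fin (2 ^ n)) :=
  highW M n β k ∩ (if k = a then lowW M n β a else lowS M n β S (pairII a) a 1)

/-- The same for the Type I receiver `r`: `H_{W_k} ∩ L_{T_{U'_k} | Y_r}`. -/
noncomputable def candI (T : Expansion n) (r k : Fin 2) : Set (Fin (2 ^ n)) :=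
  highW M n β k ∩ lowS M n β T com r k

/-- A Type B scheme: receiver `a` uses Type II decoding from block 1 to block `K`, the other one
uses Type I decoding from block `K` to block 1. -/
structure SchemeB where
  a : Fin 2
  /-- the expansion of the private sequence of sender `a` and the other common sequence -/
  S : Expansion n
  /-- the expansion of the two common sequences used at the other receiver -/
  T : Expansion n
  /-- the chosen common information indices for receiver `a` -/
  C1 : Fin 2 → Set (Fin (2 ^ n))
  /-- the chosen common information indices for the other receiver -/
  C2 : Fin 2 → Set (Fin (2 ^ n))
  C1_subset : ∀ k, C1 k ⊆ candII M n β S a k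
  C2_subset : ∀ k, C2 k ⊆ candI M n β T (other a) k
  link : Fin 2 → Equiv.Perm (Fin (2 ^ n))
  /-- `link k` restricts to a bijection of `C1 k \ C2 k` onto `C2 k \ C1 k` -/
  link_image : ∀ k, link k '' (C1 k \ C2 k) = C2 k \ C1 k

variable {M n β}

/-- The index partition of a Type A scheme. -/
noncomputable def SchemeA.layout (A : SchemeA M n β) : Layout n :=
  let C : Fin 2 → Fin 2 → Set (Fin (2 ^ n)) := fun r k => infoA M n β (A.path r) r k
  let I := fun k => C A.lead k ∩ C (other A.lead) k
  let I1 := fun k => C A.lead k \ C (other A.lead) k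
  let I2 := A.sel
  { I := I
    I1 := I1
    I2 := I2
    F := fun k => highW M n β k \ (I k ∪ I1 k ∪ I2 k)
    Ip := fun k => highXWW M n β k ∩ lowXWW M n β k
    Fp := fun k => highXWW M n β k ∩ (lowXWW M n β k)ᶜ
    link := A.link }

/-- The index partition of a Type B scheme. -/
noncomputable def SchemeB.layout (B : SchemeB M n β) : Layout n :=
  let I := fun k => B.C1 k ∩ B.C2 k
  let I1 := fun k => B.C1 k \ B.C2 k
  let I2 := fun k => B.C2 k \ B.C1 k
  { I := I
    I1 := I1
    I2 := I2
    F := fun k => highW M n β k \ (I k ∪ I1 k ∪ I2 k)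
    Ip := fun k => if k = B.a then highX M n β k ∩ lowSW M n β B.S B.a
      else highXWW M n β k ∩ lowXWW M n β k
    Fp := fun k => if k = B.a then highX M n β k ∩ (lowSW M n β B.S B.a)ᶜ
      else highXWW M n β k ∩ (lowXWW M n β k)ᶜ
    link := B.link }

open Classical in
/-- Error probability of receiver `r` (Type I) of a Type A scheme over `K` blocks. -/
noncomputable def SchemeA.errorProb (A : SchemeA M n β) (K : ℕ) (r : Fin 2) : ℝ :=
  prob (runLaw M (K := K) A.layout) fun ω => ErrorI r ω
    (if r = A.lead then decodeIFwd M A.layout β (A.path r) r ω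
     else decodeIBwd M A.layout β (A.path r) r ω)

/-- Error probability of the Type I receiver of a Type B scheme over `K` blocks. -/
noncomputable def SchemeB.errorProbI (B : SchemeB M n β) (K : ℕ) : ℝ :=
  prob (runLaw M (K := K) B.layout) fun ω =>
    ErrorI (other B.a) ω (decodeIBwd M B.layout β B.T (other B.a) ω)

/-- Error probability of the Type II receiver of a Type B scheme over `K` blocks. -/
noncomputable def SchemeB.errorProbII (B : SchemeB M n β) (K : ℕ) : ℝ :=
  prob (runLaw M (K := K) B.layout) fun ω =>
    ErrorII B.a ω (decodeII M B.layout β B.S B.a ω)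

end Schemes

end PolarIC

namespace PolarIC

/-! ### Finite probability -/

section FiniteProbability

variable {Ω α γ γ' : Type*} [Fintype Ω] {μ : Ω → ℝ}

/-! Both claims follow from one estimate linear in `K`, namely `K * (3 * x + 2 * s)` with `x = N
δ_N` and `s = √(log 2) √x`; errors propagating from block to block need not be counted.

Call a block bad if some MAP estimate made in it would be wrong even from the true earlier symbols.
If no block is bad, induction along the decoding order shows every actual estimate to be right,
since symbols copied from correctly decoded blocks are the true ones (`knownFwd_eq`, `knownBwd_eq`,
`decodeIFwd_eq`, `decodeIBwd_eq`, `decodeII_eq`). A union bound over bad blocks therefore suffices.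
It involves only the law of a single block, so the dependence created by chaining plays no role.

That law is known exactly. Given the seeds the blocks are independent (`runLaw_eq`), and the seeds
that feed any one block are uniform, so each block has the law `unifLaw`: uniform symbols at the
indices assigned by the encoders, target kernels elsewhere (`prob_runLaw_block`). By the chain rule
(`target_eq_prod_kern`) the relative entropy of the target law to `unifLaw` is the sum of the
deficits `log q - H` at the assigned indices, at most `4 N δ_N log 2` nats. A Hellinger estimate
(`prob_le_prob_add_sqrt`) turns this into a change of at most `2 * s` in any probability
(`prob_unifLaw_le`). Under the target law a MAP error is at most as likely as the conditional
entropy is large (`prob_mapEst_ne_le_condEnt`), and a receiver makes at most `3 N` estimates per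
block, each of entropy at most `δ_N`.

The linear bound is then compared with the claimed polynomials (`boundI`, `boundII`). Only for Type
II with `K = 1` does this fail coefficientwise; there a probability being at most one helps. -/

theorem prob_nonneg (hμ : ∀ ω, 0 ≤ μ ω) (E : Ω → Prop) : 0 ≤ prob μ E := by
  classical
  exact Finset.sum_nonneg fun ω _ => by split_ifs <;> simp [hμ]

/-- Inclusion is asked for on the support of `μ` only, because the encoding rules behind correct
decoding hold only there. -/
theorem prob_mono (hμ : ∀ ω, 0 ≤ μ ω) {E F : Ω → Prop} (h : ∀ ω, μ ω ≠ 0 → E ω → F ω) :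
    prob μ E ≤ prob μ F := by
  classical
  refine Finset.sum_le_sum fun ω _ => ?_
  by_cases h0 : μ ω = 0
  · simp [h0]
  · have := h ω h0
    have := hμ ω
    split_ifs <;> simp_all

theorem prob_congr {E F : Ω → Prop} (h : ∀ ω, E ω ↔ F ω) : prob μ E = prob μ F := by
  rw [show E = F from funext fun ω => propext (h ω)]

theorem prob_le_one (hμ : ∀ ω, 0 ≤ μ ω) (h1 : ∑ ω, μ ω ≤ 1) (E : Ω → Prop) : prob μ E ≤ 1 := by
  classical
  refine le_trans (Finset.sum_le_sum fun ω _ => ?_) h1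
  have := hμ ω
  split_ifs <;> simp_all

theorem prob_exists_le {ι : Type*} [Fintype ι] (hμ : ∀ ω, 0 ≤ μ ω) (E : ι → Ω → Prop) :
    prob μ (fun ω => ∃ i, E i ω) ≤ ∑ i, prob μ (E i) := by
  classical
  unfold prob
  rw [Finset.sum_comm]
  refine Finset.sum_le_sum fun ω _ => ?_
  have h0 : ∀ i ∈ (Finset.univ : Finset ι), 0 ≤ (if E i ω then μ ω else 0) := fun i _ => by
    split_ifs <;> simp [hμ]
  split_ifs with h
  · obtain ⟨i, hi⟩ := h
    have := Finset.single_le_sum h0 (Finset.mem_univ i)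
    simpa [hi] using this
  · exact Finset.sum_nonneg h0

theorem prob_or_le (hμ : ∀ ω, 0 ≤ μ ω) (E F : Ω → Prop) :
    prob μ (fun ω => E ω ∨ F ω) ≤ prob μ E + prob μ F := by
  classical
  unfold prob
  rw [← Finset.sum_add_distrib]
  refine Finset.sum_le_sum fun ω _ => ?_
  have := hμ ω
  split_ifs <;> simp_all

theorem le_prob (hμ : ∀ ω, 0 ≤ μ ω) {E : Ω → Prop} {ω : Ω} (h : E ω) : μ ω ≤ prob μ E := by
  classical
  have h0 : ∀ ω ∈ (Finset.univ : Finset Ω), 0 ≤ (if E ω then μ ω else 0) := fun i _ => by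
    split_ifs <;> simp [hμ]
  have := Finset.single_le_sum h0 (Finset.mem_univ ω)
  simpa [prob, h] using this

theorem sum_prob_and_eq [Fintype α] (f : Ω → α) (E : Ω → Prop) :
    ∑ a, prob μ (fun ω => f ω = a ∧ E ω) = prob μ E := by
  classical
  unfold prob
  rw [Finset.sum_comm]
  refine Finset.sum_congr rfl fun ω _ => ?_
  by_cases h : E ω <;> simp [h]

theorem prob_eq_mul_condLaw [Fintype α] (hμ : ∀ ω, 0 ≤ μ ω) (f : Ω → α) (g : Ω → γ) (c : γ)
    (a : α) : prob μ (fun ω => f ω = a ∧ g ω = c) =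
      prob μ (fun ω => g ω = c) * condLaw μ f g c a := by
  unfold condLaw
  split_ifs with h
  · rw [h, zero_mul]
    refine le_antisymm ?_ (prob_nonneg hμ _)
    rw [← h]
    exact prob_mono hμ fun _ _ h => h.2
  · field_simp

theorem condLaw_nonneg [Fintype α] (hμ : ∀ ω, 0 ≤ μ ω) (f : Ω → α) (g : Ω → γ) (c : γ) (a : α) :
    0 ≤ condLaw μ f g c a := by
  unfold condLaw
  split_ifs
  · positivity
  · exact div_nonneg (prob_nonneg hμ _) (prob_nonneg hμ _)

theorem sum_condLaw [Fintype α] [Nonempty α] (f : Ω → α) (g : Ω → γ)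
    (c : γ) : ∑ a, condLaw μ f g c a = 1 := by
  unfold condLaw
  split_ifs with h
  · simp
  · rw [← Finset.sum_div, sum_prob_and_eq, div_self h]

theorem condLaw_le_one [Fintype α] [Nonempty α] (hμ : ∀ ω, 0 ≤ μ ω) (f : Ω → α) (g : Ω → γ)
    (c : γ) (a : α) : condLaw μ f g c a ≤ 1 := by
  rw [← sum_condLaw (μ := μ) f g c]
  exact Finset.single_le_sum (fun a _ => condLaw_nonneg hμ f g c a) (Finset.mem_univ a)

theorem condLaw_pos [Fintype α] (hμ : ∀ ω, 0 ≤ μ ω) (f : Ω → α) (g : Ω → γ) {ω : Ω}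
    (h : μ ω ≠ 0) : 0 < condLaw μ f g (g ω) (f ω) := by
  have h1 : 0 < prob μ (fun ω' => f ω' = f ω ∧ g ω' = g ω) :=
    ((hμ ω).lt_of_ne' h).trans_le (le_prob hμ (by simp))
  rw [prob_eq_mul_condLaw hμ] at h1
  exact pos_of_mul_pos_right h1 (prob_nonneg hμ _)

theorem sum_mul_comp_eq [Fintype α] [Fintype γ] (f : Ω → α) (g : Ω → γ) (F : α → γ → ℝ) :
    ∑ ω, μ ω * F (f ω) (g ω) = ∑ c, ∑ a, prob μ (fun ω => f ω = a ∧ g ω = c) * F a c := by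
  classical
  unfold prob
  simp_rw [Finset.sum_mul]
  rw [Finset.sum_comm]
  simp_rw [Finset.sum_comm (s := Finset.univ (α := γ))]
  rw [Finset.sum_comm]
  refine Finset.sum_congr rfl fun ω _ => ?_
  rw [Finset.sum_eq_single (f ω), Finset.sum_eq_single (g ω)]
  · simp
  · exact fun c _ h => by rw [if_neg fun h' => h h'.2.symm, zero_mul]
  · simp
  · exact fun a _ h => Finset.sum_eq_zero fun c _ => by
      rw [if_neg fun h' => h h'.1.symm, zero_mul]
  · simp

theorem one_sub_le_neg_logb {p : ℝ} (h0 : 0 < p) (h1 : p ≤ 1) : 1 - p ≤ -Real.logb 2 p := by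
  have h2 : 0 < Real.log 2 := Real.log_pos one_lt_two
  -- Since `log 2 ≤ 1`, passing to binary logarithms only enlarges `-log p`, which is already at
  -- least `1 - p`.
  have h3 : Real.log 2 ≤ 1 := by
    have := Real.log_le_sub_one_of_pos (show (0 : ℝ) < 2 by norm_num)
    linarith
  have h4 := Real.log_le_sub_one_of_pos h0
  rw [Real.logb, ← neg_div, le_div_iff₀ h2]
  nlinarith

/-- The error probability of the maximum a posteriori estimate is at most the conditional
entropy. -/
theorem prob_mapEst_ne_le_condEnt [Fintype α] [Nonempty α] [Finite γ] (hμ : ∀ ω, 0 ≤ μ ω)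
    (f : Ω → α) (g : Ω → γ) :
    prob μ (fun ω => mapEst μ f g (g ω) ≠ f ω) ≤ condEnt μ f g := by
  classical
  cases nonempty_fintype γ
  -- Given `c`, the guess is right with probability `max p`, which is at least `∑ p²` because `p`
  -- sums to one. The left side is the mean of `p(f|g)`, and `1 - p ≤ -log₂ p` then brings in the
  -- entropy.
  have key : ∑ ω, μ ω * condLaw μ f g (g ω) (f ω) ≤
      ∑ ω, μ ω * (if f ω = mapEst μ f g (g ω) then 1 else 0) := by
    rw [sum_mul_comp_eq f g (fun a c => condLaw μ f g c a),
      sum_mul_comp_eq f g (fun a c => if a = mapEst μ f g c then 1 else 0)]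
    refine Finset.sum_le_sum fun c _ => ?_
    simp only [mul_ite, mul_one, mul_zero, Finset.sum_ite_eq', Finset.mem_univ, if_true,
      prob_eq_mul_condLaw hμ]
    have hmax : ∀ a, condLaw μ f g c a ≤ condLaw μ f g c (mapEst μ f g c) :=
      (Finite.exists_max (condLaw μ f g c)).choose_spec
    calc _ ≤ ∑ a, prob μ (fun ω => g ω = c) * condLaw μ f g c a *
              condLaw μ f g c (mapEst μ f g c) :=
            Finset.sum_le_sum fun a _ => mul_le_mul_of_nonneg_left (hmax a)
              (mul_nonneg (prob_nonneg hμ _) (condLaw_nonneg hμ _ _ _ _))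
      _ = _ := by rw [← Finset.sum_mul, ← Finset.mul_sum, sum_condLaw, mul_one]
  have h1 : prob μ (fun ω => mapEst μ f g (g ω) ≠ f ω) =
      ∑ ω, μ ω - ∑ ω, μ ω * (if f ω = mapEst μ f g (g ω) then 1 else 0) := by
    unfold prob
    rw [← Finset.sum_sub_distrib]
    refine Finset.sum_congr rfl fun ω _ => ?_
    by_cases h : f ω = mapEst μ f g (g ω)
    · simp [← h]
    · simp [h, Ne.symm h]
  have h2 : ∑ ω, μ ω - ∑ ω, μ ω * condLaw μ f g (g ω) (f ω) ≤ condEnt μ f g := by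
    unfold condEnt
    rw [← Finset.sum_sub_distrib, ← Finset.sum_neg_distrib]
    refine Finset.sum_le_sum fun ω _ => ?_
    by_cases h : μ ω = 0
    · simp [h]
    · have := mul_le_mul_of_nonneg_left (one_sub_le_neg_logb (condLaw_pos hμ f g h)
        (condLaw_le_one hμ _ _ _ _)) (hμ ω)
      linarith
  linarith

/-- Conditioning reduces entropy. -/
theorem condEnt_le_condEnt_comp [Fintype α] [Nonempty α] [Finite γ] (hμ : ∀ ω, 0 ≤ μ ω)
    (f : Ω → α) (g : Ω → γ) (φ : γ → γ') :
    condEnt μ f g ≤ condEnt μ f (fun ω => φ (g ω)) := by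
  classical
  cases nonempty_fintype γ
  set g' := fun ω => φ (g ω)
  have hlog2 : 0 < Real.log 2 := Real.log_pos one_lt_two
  -- Gibbs' inequality: the likelihood ratio has mean at most one, and `log t ≤ t - 1` finishes. It
  -- is only an inequality because values of conditional probability zero drop out of the mean.
  have key : ∑ ω, μ ω * (condLaw μ f g' (g' ω) (f ω) / condLaw μ f g (g ω) (f ω)) ≤ ∑ ω, μ ω := by
    have e := sum_mul_comp_eq (μ := μ) f g
      (fun a c => condLaw μ f g' (φ c) a / condLaw μ f g c a)
    have e' := sum_mul_comp_eq (μ := μ) f g (fun a c => condLaw μ f g c a / condLaw μ f g c a)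
    have e2 : ∑ ω, μ ω * (condLaw μ f g (g ω) (f ω) / condLaw μ f g (g ω) (f ω)) = ∑ ω, μ ω := by
      refine Finset.sum_congr rfl fun ω _ => ?_
      by_cases h : μ ω = 0
      · simp [h]
      · rw [div_self (condLaw_pos hμ f g h).ne', mul_one]
    rw [e, ← e2, e']
    refine Finset.sum_le_sum fun c _ => ?_
    have hp := prob_nonneg hμ (fun ω => g ω = c)
    calc _ ≤ ∑ a, prob μ (fun ω => g ω = c) * condLaw μ f g' (φ c) a := by
          refine Finset.sum_le_sum fun a _ => ?_
          rw [prob_eq_mul_condLaw hμ, mul_assoc]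
          refine mul_le_mul_of_nonneg_left ?_ hp
          by_cases h : condLaw μ f g c a = 0
          · simp [h, condLaw_nonneg hμ]
          · rw [mul_div_cancel₀ _ h]
      _ = ∑ a, prob μ (fun ω => g ω = c) * condLaw μ f g c a := by
          rw [← Finset.mul_sum, ← Finset.mul_sum, sum_condLaw, sum_condLaw]
      _ ≤ _ := by
          refine Finset.sum_le_sum fun a _ => le_of_eq ?_
          rw [prob_eq_mul_condLaw hμ, mul_assoc]
          by_cases h : condLaw μ f g c a = 0
          · simp [h]
          · rw [mul_div_cancel₀ _ h]
  have h3 : Real.log 2 * (condEnt μ f g - condEnt μ f g') ≤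
      ∑ ω, μ ω * (condLaw μ f g' (g' ω) (f ω) / condLaw μ f g (g ω) (f ω)) - ∑ ω, μ ω := by
    unfold condEnt
    rw [neg_sub_neg, ← Finset.sum_sub_distrib, ← Finset.sum_sub_distrib, Finset.mul_sum]
    refine Finset.sum_le_sum fun ω _ => ?_
    by_cases h : μ ω = 0
    · simp [h]
    · have hp := condLaw_pos hμ f g h
      have hp' := condLaw_pos hμ f g' h
      have := Real.log_le_sub_one_of_pos (div_pos hp' hp)
      rw [Real.log_div hp'.ne' hp.ne'] at this
      have := mul_le_mul_of_nonneg_left this (hμ ω)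
      simp only [Real.logb]
      field_simp
      field_simp at this
      linarith
  nlinarith

/-- Chain rule: sequentially conditioning on the earlier coordinates. -/
theorem prob_mul_prod_condLaw {m : ℕ} {A : Fin m → Type*} {G : Fin m → Type*}
    [∀ j, Fintype (A j)] (hμ : ∀ ω, 0 ≤ μ ω) (E : Ω → Prop) (f : ∀ j, Ω → A j)
    (h : ∀ j, Ω → G j) {ω : Ω} (hω : μ ω ≠ 0) (hE : E ω)
    (hh : ∀ j ω', h j ω' = h j ω ↔ E ω' ∧ ∀ i, i < j → f i ω' = f i ω) :
    prob μ E * ∏ j, condLaw μ (f j) (h j) (h j ω) (f j ω) =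
      prob μ (fun ω' => E ω' ∧ ∀ j, f j ω' = f j ω) := by
  -- `T l` is the probability of `E` together with agreement with `ω` in the first `l` coordinates.
  -- Each conditional law is a ratio of consecutive `T`, nonzero because `ω` has mass, and the
  -- product telescopes.
  set T : ℕ → ℝ := fun l => prob μ (fun ω' => E ω' ∧ ∀ j : Fin m, j.val < l → f j ω' = f j ω)
  have hT : ∀ l, T l ≠ 0 := fun l =>
    (((hμ ω).lt_of_ne' hω).trans_le (le_prob hμ (by simp [hE]))).ne'
  have hstep : ∀ j : Fin m, condLaw μ (f j) (h j) (h j ω) (f j ω) = T (j + 1) / T j := by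
    intro j
    have h1 : prob μ (fun ω' => h j ω' = h j ω) = T j := prob_congr fun ω' => hh j ω'
    have h2 : prob μ (fun ω' => f j ω' = f j ω ∧ h j ω' = h j ω) = T (j + 1) := by
      refine prob_congr fun ω' => ?_
      rw [hh]
      constructor
      · rintro ⟨a, b, c⟩
        refine ⟨b, fun i hi => ?_⟩
        rcases Nat.lt_succ_iff_lt_or_eq.mp hi with h | h
        · exact c i h
        · rw [Fin.ext h]; exact a
      · rintro ⟨b, c⟩
        exact ⟨c j (Nat.lt_succ_self _), b, fun i hi => c i (Nat.lt_succ_of_lt hi)⟩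
    rw [condLaw, h1, h2, if_neg (hT j)]
  have hprod : ∀ l, ∏ i ∈ Finset.range l, T (i + 1) / T i = T l / T 0 := by
    intro l
    induction l with
    | zero => simp [hT 0]
    | succ l ih => rw [Finset.prod_range_succ, ih, mul_comm, div_mul_div_cancel₀ (hT l)]
  simp_rw [hstep]
  rw [Fin.prod_univ_eq_prod_range (fun i => T (i + 1) / T i) m, hprod]
  have h0 : prob μ E = T 0 := prob_congr fun ω' => by simp
  rw [h0, mul_div_cancel₀ _ (hT 0)]
  exact prob_congr fun ω' => by simp

/-- A weak form of Pinsker's inequality: `L` is the log-likelihood ratio of `μ` to `ν`. -/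
theorem prob_le_prob_add_sqrt {ν : Ω → ℝ} (hμ : ∀ ω, 0 ≤ μ ω) (hν : ∀ ω, 0 ≤ ν ω)
    (hμ1 : ∑ ω, μ ω = 1) (hν1 : ∑ ω, ν ω = 1) (L : Ω → ℝ)
    (hL : ∀ ω, μ ω ≠ 0 → ν ω = μ ω * Real.exp (-L ω)) {D : ℝ} (hD : ∑ ω, μ ω * L ω ≤ D)
    (E : Ω → Prop) : prob ν E ≤ prob μ E + √D := by
  classical
  have hsq : ∀ ω, (√(ν ω) - √(μ ω)) ^ 2 = ν ω + μ ω - 2 * (√(ν ω) * √(μ ω)) := fun ω => by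
    have := Real.sq_sqrt (hμ ω)
    have := Real.sq_sqrt (hν ω)
    nlinarith
  have hsq' : ∀ ω, (√(ν ω) + √(μ ω)) ^ 2 = ν ω + μ ω + 2 * (√(ν ω) * √(μ ω)) := fun ω => by
    have := Real.sq_sqrt (hμ ω)
    have := Real.sq_sqrt (hν ω)
    nlinarith
  -- The squared Hellinger distance is `2 - 2 ∑ √(μ ν)`, and on the support of `μ` one has `√(μ ν) =
  -- μ exp(-L/2) ≥ μ (1 - L/2)`.
  have hH : ∑ ω, (√(ν ω) - √(μ ω)) ^ 2 ≤ D := by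
    have hpt : ∀ ω, μ ω - 2⁻¹ * (μ ω * L ω) ≤ √(ν ω) * √(μ ω) := by
      intro ω
      by_cases h : μ ω = 0
      · simp [h]
      · have e : √(ν ω) * √(μ ω) = μ ω * Real.exp (-L ω / 2) := by
          rw [← Real.sqrt_mul (hν ω), hL ω h, Real.sqrt_eq_iff_mul_self_eq
            (by have := hμ ω; positivity) (by have := hμ ω; positivity)]
          have : Real.exp (-L ω) = Real.exp (-L ω / 2) * Real.exp (-L ω / 2) := by
            rw [← Real.exp_add]; ring_nf
          rw [this]; ring
        rw [e]
        have := mul_le_mul_of_nonneg_left (Real.add_one_le_exp (-L ω / 2)) (hμ ω)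
        linarith
    have := Finset.sum_le_sum fun ω (_ : ω ∈ Finset.univ) => hpt ω
    simp_rw [hsq]
    rw [Finset.sum_sub_distrib, Finset.sum_add_distrib, ← Finset.mul_sum, hμ1, hν1]
    rw [Finset.sum_sub_distrib, ← Finset.mul_sum, hμ1] at this
    linarith
  have hP : ∑ ω, (√(ν ω) + √(μ ω)) ^ 2 ≤ 4 := by
    have : ∀ ω, (√(ν ω) + √(μ ω)) ^ 2 ≤ 2 * ν ω + 2 * μ ω := fun ω => by
      have := hsq ω
      have := hsq' ω
      nlinarith [sq_nonneg (√(ν ω) - √(μ ω))]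
    refine (Finset.sum_le_sum fun ω _ => this ω).trans ?_
    rw [Finset.sum_add_distrib, ← Finset.mul_sum, ← Finset.mul_sum, hμ1, hν1]
    norm_num
  -- Cauchy–Schwarz for `|ν - μ| = |√ν - √μ| |√ν + √μ|`, whose factors have squares summing to at
  -- most `D` and `4`.
  have habs : ∑ ω, |ν ω - μ ω| ≤ 2 * √D := by
    have e : ∀ ω, |ν ω - μ ω| = |√(ν ω) - √(μ ω)| * |√(ν ω) + √(μ ω)| := fun ω => by
      rw [← abs_mul]
      congr 1
      have := Real.sq_sqrt (hμ ω)
      have := Real.sq_sqrt (hν ω)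
      nlinarith
    simp_rw [e]
    have hcs := Finset.sum_mul_sq_le_sq_mul_sq Finset.univ (fun ω => |√(ν ω) - √(μ ω)|)
      (fun ω => |√(ν ω) + √(μ ω)|)
    simp only [sq_abs] at hcs
    have h0 : 0 ≤ ∑ ω, (√(ν ω) - √(μ ω)) ^ 2 := Finset.sum_nonneg fun _ _ => sq_nonneg _
    have hb : (∑ ω, |√(ν ω) - √(μ ω)| * |√(ν ω) + √(μ ω)|) ^ 2 ≤ (2 * √D) ^ 2 := by
      rw [mul_pow, Real.sq_sqrt (h0.trans hH)]
      refine hcs.trans ?_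
      nlinarith
    exact (le_abs_self _).trans (abs_le_of_sq_le_sq hb (by positivity))
  have hE : ∀ F : Ω → Prop, prob ν F - prob μ F ≤ ∑ ω, if F ω then |ν ω - μ ω| else 0 := by
    intro F
    unfold prob
    rw [← Finset.sum_sub_distrib]
    refine Finset.sum_le_sum fun ω _ => ?_
    split_ifs
    · exact le_abs_self _
    · simp
  have hE' : ∀ F : Ω → Prop, prob μ F - prob ν F ≤ ∑ ω, if F ω then |ν ω - μ ω| else 0 := by
    intro F
    unfold prob
    rw [← Finset.sum_sub_distrib]
    refine Finset.sum_le_sum fun ω _ => ?_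
    split_ifs
    · rw [abs_sub_comm]; exact le_abs_self _
    · simp
  -- Both masses are one, so `ν` exceeds `μ` on `E` by as much as it falls short on the complement.
  -- Adding the two bounds gains the factor `1/2` that turns `2√D` into `√D`.
  have hc : ∀ ρ : Ω → ℝ, prob ρ E + prob ρ (fun ω => ¬E ω) = ∑ ω, ρ ω := by
    intro ρ
    unfold prob
    rw [← Finset.sum_add_distrib]
    exact Finset.sum_congr rfl fun ω _ => by by_cases h : E ω <;> simp [h]
  have hs : (∑ ω, if E ω then |ν ω - μ ω| else 0) + (∑ ω, if ¬E ω then |ν ω - μ ω| else 0) =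
      ∑ ω, |ν ω - μ ω| := by
    rw [← Finset.sum_add_distrib]
    exact Finset.sum_congr rfl fun ω _ => by by_cases h : E ω <;> simp [h]
  have h1 := hE E
  have h2 : prob μ (fun ω => ¬E ω) - prob ν (fun ω => ¬E ω) ≤
      ∑ ω, if ¬E ω then |ν ω - μ ω| else 0 := by
    convert hE' fun ω => ¬E ω
  have h3 := hc μ
  have h4 := hc ν
  linarith

end FiniteProbability

/-- A product of conditional laws is a law. -/
theorem sum_prod_sequential {A : Type*} [Fintype A] [Nonempty A] :
    ∀ {m : ℕ} (F : Fin m → (Fin m → A) → ℝ),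
      (∀ j u u', (∀ i, i ≤ j → u i = u' i) → F j u = F j u') →
      (∀ j u, ∑ a, F j (Function.update u j a) = 1) → ∑ u, ∏ j, F j u = 1 := by
  intro m
  induction m with
  | zero => intro F _ _; simp
  | succ m ih =>
    intro F hdep hsum
    -- `a₀` merely fills the last coordinate, on which the earlier factors do not depend; the last
    -- factor sums to one and drops out.
    obtain ⟨a₀⟩ := ‹Nonempty A›
    rw [← (Fin.snocEquiv fun _ => A).sum_comp, Fintype.sum_prod_type_right]
    have h1 : ∀ (v : Fin m → A) (a : A), ∏ j, F j (Fin.snoc (α := fun _ => A) v a) =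
        (∏ j : Fin m, F j.castSucc (Fin.snoc (α := fun _ => A) v a₀)) *
          F (Fin.last m) (Function.update (Fin.snoc (α := fun _ => A) v a₀) (Fin.last m) a) := by
      intro v a
      rw [Fin.prod_univ_castSucc, Fin.update_snoc_last]
      congr 1
      refine Finset.prod_congr rfl fun j _ => hdep _ _ _ fun i hi => ?_
      have : i = Fin.castSucc (i.castPred (Fin.ne_last_of_lt (hi.trans_lt j.castSucc_lt_last))) := by
        simp
      rw [this, Fin.snoc_castSucc, Fin.snoc_castSucc]
    simp only [Fin.snocEquiv, Equiv.coe_fn_mk]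
    simp_rw [h1, ← Finset.mul_sum, hsum, mul_one]
    refine ih (fun j v => F j.castSucc (Fin.snoc (α := fun _ => A) v a₀)) ?_ ?_
    · intro j u u' h
      refine hdep _ _ _ fun i hi => ?_
      have : i = Fin.castSucc (i.castPred (Fin.ne_last_of_lt (hi.trans_lt j.castSucc_lt_last))) := by
        simp
      rw [this, Fin.snoc_castSucc, Fin.snoc_castSucc]
      exact h _ (by rw [← Fin.castSucc_le_castSucc_iff]; simpa using hi)
    · intro j u
      rw [← hsum j.castSucc (Fin.snoc (α := fun _ => A) u a₀)]
      simp_rw [Fin.snoc_update]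

end PolarIC

namespace PolarIC
variable {q : Stream → ℕ} [∀ s, Fact (q s).Prime] {Y : Fin 2 → Type*} [∀ r, Fintype (Y r)]

/-! ### The polar transform is invertible -/

/-- Kronecker powers are multiplicative, so the power of the inverse kernel inverts the power of the
kernel. -/
theorem isUnit_det_kernelPow (n : ℕ) (R : Type*) [CommRing R] : IsUnit (kernelPow n R).det := by
  rw [← Matrix.isUnit_iff_isUnit_det]
  have hmul : ∀ a b : Matrix (Fin 2) (Fin 2) R, a * b = 1 →
      (Matrix.of fun i j : Fin (2 ^ n) => ∏ k : Fin n,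
        a (finFunctionFinEquiv.symm i k) (finFunctionFinEquiv.symm j k)) *
      (Matrix.of fun i j : Fin (2 ^ n) => ∏ k : Fin n,
        b (finFunctionFinEquiv.symm i k) (finFunctionFinEquiv.symm j k)) = 1 := by
    intro a b hab
    ext i l
    rw [Matrix.mul_apply]
    simp only [Matrix.of_apply, ← Finset.prod_mul_distrib]
    rw [finFunctionFinEquiv.symm.sum_comp (fun c : Fin n → Fin 2 => ∏ k,
      a (finFunctionFinEquiv.symm i k) (c k) * b (c k) (finFunctionFinEquiv.symm l k))]
    rw [← Fintype.prod_sum (fun k c => a (finFunctionFinEquiv.symm i k) c *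
      b c (finFunctionFinEquiv.symm l k))]
    have hab' : ∀ i l, ∑ c, a i c * b c l = (1 : Matrix (Fin 2) (Fin 2) R) i l := fun i l => by
      rw [← hab, Matrix.mul_apply]
    refine (Finset.prod_congr rfl fun k _ => hab' _ _).trans ?_
    by_cases h : i = l
    · subst h
      rw [Matrix.one_apply_eq]
      exact Finset.prod_eq_one fun k _ => Matrix.one_apply_eq _
    · rw [Matrix.one_apply_ne h]
      have : ∃ k, finFunctionFinEquiv.symm i k ≠ finFunctionFinEquiv.symm l k := by
        by_contra! h'
        exact h (finFunctionFinEquiv.symm.injective (funext h'))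
      obtain ⟨k, hk⟩ := this
      exact Finset.prod_eq_zero (Finset.mem_univ k) (Matrix.one_apply_ne hk)
  have h1 : (!![1, 0; 1, 1] : Matrix (Fin 2) (Fin 2) R) * !![1, 0; -1, 1] = 1 := by
    simp [Matrix.one_fin_two]
  have h2 : (!![1, 0; -1, 1] : Matrix (Fin 2) (Fin 2) R) * !![1, 0; 1, 1] = 1 := by
    simp [Matrix.one_fin_two]
  exact ⟨⟨_, _, hmul _ _ h1, hmul _ _ h2⟩, rfl⟩

theorem isUnit_det_polarMatrix (n : ℕ) (R : Type*) [CommRing R] :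
    IsUnit (polarMatrix n R).det := by
  rw [polarMatrix, Matrix.det_mul, Matrix.det_permutation]
  refine IsUnit.mul ?_ (isUnit_det_kernelPow n R)
  exact ((Equiv.Perm.sign (bitRev n)).isUnit.map (Int.castRingHom R))

/-- The block of letters with given transformed sequences and outputs. -/
noncomputable def toBlock (n : ℕ) :
    ((∀ s, Fin (2 ^ n) → ZMod (q s)) × (Fin (2 ^ n) → ∀ r, Y r)) ≃ Block q Y n where
  toFun p t := (fun s => (p.1 s ᵥ* (polarMatrix n (ZMod (q s)))⁻¹) t, p.2 t)
  invFun b := (fun s => whole s b, fun t => (b t).2)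
  left_inv p := by
    refine Prod.ext (funext fun s => funext fun j => ?_) rfl
    simp [whole, sym, Matrix.vecMul_vecMul, Matrix.nonsing_inv_mul _ (isUnit_det_polarMatrix n _)]
  right_inv b := by
    refine funext fun t => Prod.ext (funext fun s => ?_) rfl
    have : whole s b = (fun t => (b t).1 s) ᵥ* polarMatrix n (ZMod (q s)) := rfl
    simp [this, Matrix.vecMul_vecMul, Matrix.mul_nonsing_inv _ (isUnit_det_polarMatrix n _)]

@[simp]
theorem sym_toBlock {n : ℕ} (u : ∀ s, Fin (2 ^ n) → ZMod (q s)) (y : Fin (2 ^ n) → ∀ r, Y r)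
    (s : Stream) (j : Fin (2 ^ n)) : sym s j (toBlock n (u, y)) = u s j :=
  congrFun (congrFun (congrArg Prod.fst ((toBlock n).symm_apply_apply (u, y))) s) j

@[simp]
theorem whole_toBlock {n : ℕ} (u : ∀ s, Fin (2 ^ n) → ZMod (q s)) (y : Fin (2 ^ n) → ∀ r, Y r)
    (s : Stream) : whole s (toBlock n (u, y)) = u s :=
  funext fun _ => sym_toBlock u y s _

@[simp]
theorem past_toBlock {n : ℕ} (u : ∀ s, Fin (2 ^ n) → ZMod (q s)) (y : Fin (2 ^ n) → ∀ r, Y r)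
    (s : Stream) (j : Fin (2 ^ n)) : past s j (toBlock n (u, y)) = fun i => u s i.1 :=
  funext fun _ => sym_toBlock u y s _

@[simp]
theorem out_toBlock {n : ℕ} (u : ∀ s, Fin (2 ^ n) → ZMod (q s)) (y : Fin (2 ^ n) → ∀ r, Y r)
    (r : Fin 2) : out r (toBlock n (u, y)) = fun t => y t r := rfl

/-- The chain rule yields events about transformed symbols, while probabilities factor over time for
events about letters; invertibility of the transform identifies the two. -/
theorem letters_eq_iff {n : ℕ} (s : Stream) (b b' : Block q Y n) :
    (∀ t, (b' t).1 s = (b t).1 s) ↔ ∀ j, sym s j b' = sym s j b := by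
  constructor
  · intro h j
    simp only [sym, h]
  · intro h t
    have h1 : ∀ b : Block q Y n, (b t).1 s =
        (whole s b ᵥ* (polarMatrix n (ZMod (q s)))⁻¹) t := fun b =>
      (congrFun (congrArg Prod.fst (congrFun ((toBlock n).apply_symm_apply b) t)) s).symm
    rw [h1 b, h1 b', show whole s b' = whole s b from funext h]

/-! ### The target law -/

/-- A family over the streams as a family of pairs over the senders. -/
def streamEquiv (A : Stream → Type*) : (∀ s, A s) ≃ ∀ k, A (com k) × A (priv k) where
  toFun u k := (u (com k), u (priv k))
  invFun p := fun s => match s with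
    | Sum.inl k => (p k).1
    | Sum.inr k => (p k).2
  left_inv u := by funext s; cases s <;> rfl
  right_inv p := rfl

theorem sum_prod_stream {A : Stream → Type*} [∀ s, Fintype (A s)]
    (Φ : ∀ k, A (com k) → A (priv k) → ℝ) :
    ∑ u : ∀ s, A s, ∏ k, Φ k (u (com k)) (u (priv k)) =
      ∏ k, ∑ p : A (com k) × A (priv k), Φ k p.1 p.2 := by
  rw [Fintype.prod_sum (fun k (p : A (com k) × A (priv k)) => Φ k p.1 p.2)]
  exact (streamEquiv A).sum_comp (fun p => ∏ k, Φ k (p k).1 (p k).2)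

section Target

variable (M : Model q Y) {n : ℕ}

theorem target_nonneg (b : Block q Y n) : 0 ≤ M.target n b :=
  Finset.prod_nonneg fun _ _ => mul_nonneg
    (Finset.prod_nonneg fun _ _ => (M.input_mem _).1 _) ((M.chan_mem _).1 _)

/-- Summing out the channel outputs leaves two independent senders. -/
theorem sum_letter (Φ : ∀ k, ZMod (q (com k)) → ZMod (q (priv k)) → ℝ) :
    ∑ l : Letter q Y, (∏ k, Φ k (l.1 (com k)) (l.1 (priv k))) *
      M.chan (fun k => l.1 (priv k)) l.2 =
      ∏ k, ∑ p : ZMod (q (com k)) × ZMod (q (priv k)), Φ k p.1 p.2 := by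
  rw [Fintype.sum_prod_type, ← sum_prod_stream (A := fun s => ZMod (q s)) Φ]
  refine Finset.sum_congr rfl fun u _ => ?_
  dsimp only
  rw [← Finset.mul_sum]
  simp only [(M.chan_mem _).2, mul_one]

theorem sum_target : ∑ b : Block q Y n, M.target n b = 1 := by
  have := Fintype.prod_sum (fun (_ : Fin (2 ^ n)) (l : Letter q Y) =>
    (∏ k, M.input k (l.1 (com k), l.1 (priv k))) * M.chan (fun k => l.1 (priv k)) l.2)
  unfold Model.target
  rw [← this]
  simp only [sum_letter M fun k w x => M.input k (w, x), (M.input_mem _).2, Finset.prod_const_one]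

theorem prob_target_letters (b : Block q Y n) (k : Fin 2) :
    prob (M.target n) (fun b' => (∀ t, (b' t).1 (com k) = (b t).1 (com k)) ∧
      ∀ t, (b' t).1 (priv k) = (b t).1 (priv k)) =
      ∏ t, M.input k ((b t).1 (com k), (b t).1 (priv k)) := by
  classical
  -- The agreement condition is imposed on sender `k` alone, so the factor of the other sender sums
  -- to one.
  let Φ : Fin (2 ^ n) → ∀ k', ZMod (q (com k')) → ZMod (q (priv k')) → ℝ := fun t k' w x =>
    if k' = k → w = (b t).1 (com k') ∧ x = (b t).1 (priv k') then M.input k' (w, x) else 0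
  have h1 : ∀ t, ∏ k', ∑ p : ZMod (q (com k')) × ZMod (q (priv k')), Φ t k' p.1 p.2 =
      M.input k ((b t).1 (com k), (b t).1 (priv k)) := by
    intro t
    rw [Finset.prod_eq_single k]
    · rw [Finset.sum_eq_single ((b t).1 (com k), (b t).1 (priv k))]
      · simp [Φ]
      · rintro ⟨w, x⟩ _ h
        simp only [Φ, true_imp_iff]
        rw [if_neg]
        rintro ⟨rfl, rfl⟩
        exact h rfl
      · simp
    · intro k' _ h
      simp [Φ, h, (M.input_mem _).2]
    · simp
  simp_rw [← h1, ← sum_letter M]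
  rw [Fintype.prod_sum (fun t (l : Letter q Y) => (∏ k', Φ t k' (l.1 (com k')) (l.1 (priv k'))) *
      M.chan (fun k => l.1 (priv k)) l.2)]
  refine Finset.sum_congr rfl fun b' _ => ?_
  split_ifs with h
  · refine Finset.prod_congr rfl fun t _ => ?_
    congr 1
    refine Finset.prod_congr rfl fun k' _ => ?_
    simp only [Φ]
    rw [if_pos]
    rintro rfl
    exact ⟨h.1 t, h.2 t⟩
  · symm
    have : ∃ t, ¬((b' t).1 (com k) = (b t).1 (com k) ∧ (b' t).1 (priv k) = (b t).1 (priv k)) := by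
      by_contra! h'
      exact h ⟨fun t => (h' t).1, fun t => (h' t).2⟩
    obtain ⟨t, ht⟩ := this
    refine Finset.prod_eq_zero (Finset.mem_univ t) (mul_eq_zero_of_left ?_ _)
    refine Finset.prod_eq_zero (Finset.mem_univ k) ?_
    simp only [Φ, true_imp_iff]
    rw [if_neg ht]

/-- The conditional probability under the target law of the symbol `j` of the stream `s` given the
symbols from which the encoder draws it. -/
noncomputable def kern : ∀ (_ : Stream) (_ : Fin (2 ^ n)) (_ : Block q Y n), ℝ
  | Sum.inl k, j, b => condLaw (M.target n) (sym (com k) j) (past (com k) j)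
      (past (com k) j b) (sym (com k) j b)
  | Sum.inr k, j, b => condLaw (M.target n) (sym (priv k) j)
      (fun b => (whole (com k) b, past (priv k) j b))
      (whole (com k) b, past (priv k) j b) (sym (priv k) j b)

theorem kern_pos (s : Stream) (j : Fin (2 ^ n)) {b : Block q Y n} (hb : M.target n b ≠ 0) :
    0 < kern M s j b := by
  cases s
  · exact condLaw_pos (target_nonneg M) _ _ hb
  · exact condLaw_pos (target_nonneg M) _ (fun b => (whole (com _) b, past (priv _) j b)) hb

theorem kern_nonneg (s : Stream) (j : Fin (2 ^ n)) (b : Block q Y n) : 0 ≤ kern M s j b := by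
  cases s <;> exact condLaw_nonneg (target_nonneg M) _ _ _ _

/-- The target law as a product of conditional laws in the order of encoding. -/
theorem target_eq_prod_kern {b : Block q Y n} (hb : M.target n b ≠ 0) :
    M.target n b = (∏ s, ∏ j, kern M s j b) *
      ∏ t, M.chan (fun k => (b t).1 (priv k)) (b t).2 := by
  have hkey : ∀ k, (∏ j, kern M (com k) j b) * ∏ j, kern M (priv k) j b =
      ∏ t, M.input k ((b t).1 (com k), (b t).1 (priv k)) := by
    intro k
    -- The chain rule is used twice per sender: along the common sequence, then along the private
    -- one given the whole common one. The final event of the first use is the initial event of the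
    -- second.
    have h1 := prob_mul_prod_condLaw (μ := M.target n) (target_nonneg M) (fun _ => True)
      (fun j => sym (com k) j) (fun j => past (com k) j) hb trivial (fun j b' => by
        rw [true_and, funext_iff]
        exact ⟨fun h i hi => h ⟨i, hi⟩, fun h i => h i.1 i.2⟩)
    have h2 := prob_mul_prod_condLaw (μ := M.target n) (target_nonneg M)
      (fun b' => True ∧ ∀ j, sym (com k) j b' = sym (com k) j b)
      (fun j => sym (priv k) j) (fun j b => (whole (com k) b, past (priv k) j b)) hb (by simp)
      (fun j b' => by
        rw [true_and, Prod.mk.injEq, funext_iff, funext_iff]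
        exact and_congr Iff.rfl ⟨fun h i hi => h ⟨i, hi⟩, fun h i => h i.1 i.2⟩)
    rw [← h1, show prob (M.target n) (fun _ => True) = 1 by simp [prob, sum_target], one_mul] at h2
    refine h2.trans ?_
    rw [← prob_target_letters M b k]
    exact prob_congr fun b' => by rw [letters_eq_iff, letters_eq_iff, true_and]
  rw [Fintype.prod_sum_type, ← Finset.prod_mul_distrib, Finset.prod_congr rfl fun k _ => hkey k,
    Finset.prod_comm, ← Finset.prod_mul_distrib]
  rfl

/-! ### The law of an encoded block -/

open Classical in
/-- The law of a block in which the symbols at the indices `V s` of the stream `s` have the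
laws `ρ s j`, and the other ones are drawn from the target law given the previous symbols. -/
noncomputable def encLaw (V : Stream → Set (Fin (2 ^ n)))
    (ρ : ∀ s, Fin (2 ^ n) → ZMod (q s) → ℝ) (b : Block q Y n) : ℝ :=
  (∏ s, ∏ j, if j ∈ V s then ρ s j (sym s j b) else kern M s j b) *
    ∏ t, M.chan (fun k => (b t).1 (priv k)) (b t).2

theorem encLaw_nonneg (V : Stream → Set (Fin (2 ^ n)))
    {ρ : ∀ s, Fin (2 ^ n) → ZMod (q s) → ℝ} (hρ : ∀ s j a, 0 ≤ ρ s j a) (b : Block q Y n) :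
    0 ≤ encLaw M V ρ b := by
  refine mul_nonneg (Finset.prod_nonneg fun s _ => Finset.prod_nonneg fun j _ => ?_)
    (Finset.prod_nonneg fun _ _ => (M.chan_mem _).1 _)
  split_ifs
  · exact hρ _ _ _
  · exact kern_nonneg M _ _ _

theorem sum_encLaw (V : Stream → Set (Fin (2 ^ n)))
    {ρ : ∀ s, Fin (2 ^ n) → ZMod (q s) → ℝ} (hρ : ∀ s j, ∑ a, ρ s j a = 1) :
    ∑ b, encLaw M V ρ b = 1 := by
  classical
  let Fc : ∀ k, Fin (2 ^ n) → (Fin (2 ^ n) → ZMod (q (com k))) → ℝ := fun k j w =>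
    if j ∈ V (com k) then ρ (com k) j (w j) else
      condLaw (M.target n) (sym (com k) j) (past (com k) j) (fun i => w i.1) (w j)
  let Fp : ∀ k, (Fin (2 ^ n) → ZMod (q (com k))) → Fin (2 ^ n) →
      (Fin (2 ^ n) → ZMod (q (priv k))) → ℝ := fun k w j x =>
    if j ∈ V (priv k) then ρ (priv k) j (x j) else
      condLaw (M.target n) (sym (priv k) j) (fun b => (whole (com k) b, past (priv k) j b))
        (w, fun i => x i.1) (x j)
  have hb : ∀ u y, encLaw M V ρ (toBlock n (u, y)) =
      (∏ k, (∏ j, Fc k j (u (com k))) * ∏ j, Fp k (u (com k)) j (u (priv k))) *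
      ∏ t, M.chan (fun k => (u (priv k) ᵥ* (polarMatrix n (ZMod (q (priv k))))⁻¹) t) (y t) := by
    intro u y
    rw [encLaw, Fintype.prod_sum_type, ← Finset.prod_mul_distrib]
    simp only [sym_toBlock, kern, whole_toBlock, past_toBlock, Fc, Fp]
    rfl
  -- Summation runs against the order of encoding: outputs, then private sequences, then common
  -- ones, each stage giving one.
  rw [← (toBlock n).sum_comp, Fintype.sum_prod_type]
  simp_rw [hb, ← Finset.mul_sum]
  have hy : ∀ x : Fin (2 ^ n) → ∀ k, ZMod (q (priv k)),
      ∑ y : Fin (2 ^ n) → ∀ r, Y r, ∏ t, M.chan (x t) (y t) = 1 := by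
    intro x
    rw [← Fintype.prod_sum fun t y => M.chan (x t) y]
    simp [(M.chan_mem _).2]
  have hy' := fun u : ∀ s, Fin (2 ^ n) → ZMod (q s) =>
    hy fun t k => (u (priv k) ᵥ* (polarMatrix n (ZMod (q (priv k))))⁻¹) t
  simp_rw [hy', mul_one]
  rw [sum_prod_stream (A := fun s => Fin (2 ^ n) → ZMod (q s))
    (fun k w x => (∏ j, Fc k j w) * ∏ j, Fp k w j x)]
  refine Finset.prod_eq_one fun k _ => ?_
  rw [Fintype.sum_prod_type]
  simp_rw [← Finset.mul_sum]
  have hp : ∀ w, ∑ x, ∏ j, Fp k w j x = 1 := by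
    intro w
    refine sum_prod_sequential _ (fun j u u' h => ?_) (fun j u => ?_)
    · simp only [Fp]
      rw [h j le_rfl, show (fun i : {i // i < j} => u i.1) = fun i => u' i.1 from
        funext fun i => h i.1 i.2.le]
    · simp only [Fp, Function.update_self]
      split_ifs
      · exact hρ _ _
      · have : ∀ a, (fun i : {i // i < j} => Function.update u j a i.1) = fun i => u i.1 :=
          fun a => funext fun i => Function.update_of_ne i.2.ne _ _
        simp_rw [this]
        exact sum_condLaw _ _ _
  have hc : ∑ w, ∏ j, Fc k j w = 1 := by
    refine sum_prod_sequential _ (fun j u u' h => ?_) (fun j u => ?_)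
    · simp only [Fc]
      rw [h j le_rfl, show (fun i : {i // i < j} => u i.1) = fun i => u' i.1 from
        funext fun i => h i.1 i.2.le]
    · simp only [Fc, Function.update_self]
      split_ifs
      · exact hρ _ _
      · have : ∀ a, (fun i : {i // i < j} => Function.update u j a i.1) = fun i => u i.1 :=
          fun a => funext fun i => Function.update_of_ne i.2.ne _ _
        simp_rw [this]
        exact sum_condLaw _ _ _
  simp_rw [hp, mul_one, hc]

/-- The law of a block whose symbols at the indices `V s` are uniform. -/
noncomputable def unifLaw (V : Stream → Set (Fin (2 ^ n))) : Block q Y n → ℝ :=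
  encLaw M V fun s _ _ => 1 / (q s : ℝ)

theorem q_pos (s : Stream) : (0 : ℝ) < q s := Nat.cast_pos.2 (Fact.out : (q s).Prime).pos

theorem sum_unif (s : Stream) : ∑ _a : ZMod (q s), 1 / (q s : ℝ) = 1 := by
  have := (q_pos (q := q) s).ne'
  simp [ZMod.card, this]

/-- The entropy of the symbol `j` of the stream `s` given the symbols from which the encoder draws
it. -/
noncomputable def encEnt (s : Stream) (j : Fin (2 ^ n)) : ℝ :=
  -∑ b, M.target n b * Real.logb 2 (kern M s j b)

/-- If the symbols made uniform are nearly uniform under the target law, the law of the block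
is close to the target law. -/
theorem prob_unifLaw_le (V : Stream → Set (Fin (2 ^ n))) {δ : ℝ} (hδ : 0 ≤ δ)
    (hV : ∀ s, ∀ j ∈ V s, Real.logb 2 (q s) - δ ≤ encEnt M s j) (E : Block q Y n → Prop) :
    prob (unifLaw M V) E ≤
      prob (M.target n) E + 2 * (√(Real.log 2) * √((2 ^ n : ℕ) * δ)) := by
  classical
  have hlog2 : 0 < Real.log 2 := Real.log_pos one_lt_two
  -- The `4` counts the streams: each of `4 N` indices adds at most `δ log 2` nats to the relative
  -- entropy.
  have hD : 2 * (√(Real.log 2) * √((2 ^ n : ℕ) * δ)) =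
      √(4 * ((2 ^ n : ℕ) * (Real.log 2 * δ))) := by
    have h4 : √(2 ^ 2 * (Real.log 2 * ((2 ^ n : ℕ) * δ))) =
        2 * √(Real.log 2 * ((2 ^ n : ℕ) * δ)) := by
      rw [Real.sqrt_mul (by norm_num), Real.sqrt_sq (by norm_num)]
    rw [← Real.sqrt_mul hlog2.le, ← h4]
    congr 1
    ring
  rw [hD]
  refine prob_le_prob_add_sqrt (target_nonneg M)
    (encLaw_nonneg M V fun s _ _ => one_div_nonneg.2 (q_pos s).le) (sum_target M)
    (sum_encLaw M V fun s _ => sum_unif s)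
    -- The log-likelihood ratio of the target law to `unifLaw`; the kernels outside `V` and the
    -- channel factors cancel.
    (fun b => ∑ s, ∑ j, if j ∈ V s then Real.log (q s) + Real.log (kern M s j b) else 0)
    (fun b hb => ?_) ?_ E
  · rw [target_eq_prod_kern M hb, encLaw, ← Finset.sum_neg_distrib, Real.exp_sum, mul_right_comm,
      ← Finset.prod_mul_distrib]
    congr 1
    refine Finset.prod_congr rfl fun s _ => ?_
    rw [← Finset.sum_neg_distrib, Real.exp_sum, ← Finset.prod_mul_distrib]
    refine Finset.prod_congr rfl fun j _ => ?_
    have h1 := kern_pos M s j hb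
    have h2 := q_pos (q := q) s
    split_ifs
    · rw [Real.exp_neg, Real.exp_add, Real.exp_log h1, Real.exp_log h2]
      field_simp
    · simp
  · simp_rw [Finset.mul_sum]
    rw [Finset.sum_comm]
    simp_rw [Finset.sum_comm (s := (Finset.univ : Finset (Block q Y n)))]
    have : ∀ s (j : Fin (2 ^ n)), ∑ b, M.target n b *
        (if j ∈ V s then Real.log (q s) + Real.log (kern M s j b) else 0) ≤ Real.log 2 * δ := by
      intro s j
      split_ifs with h
      · have h1 := hV s j h
        have h2 : ∑ b, M.target n b * (Real.log (q s) + Real.log (kern M s j b)) =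
            Real.log 2 * (Real.logb 2 (q s) - encEnt M s j) := by
          simp only [encEnt, Real.logb, mul_add, Finset.sum_add_distrib, ← Finset.sum_mul,
            sum_target, sub_neg_eq_add, Finset.mul_sum]
          congr 1
          · field_simp
          · exact Finset.sum_congr rfl fun b _ => by field_simp
        rw [h2]
        exact mul_le_mul_of_nonneg_left (by linarith) hlog2.le
      · simp only [mul_zero, Finset.sum_const_zero]
        positivity
    refine (Finset.sum_le_sum fun s _ => Finset.sum_le_sum fun j _ => this s j).trans ?_
    simp only [Finset.sum_const, Finset.card_univ, Fintype.card_fin, Fintype.card_sum,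
      nsmul_eq_mul]
    push_cast
    linarith

end Target

end PolarIC

namespace PolarIC
variable {q : Stream → ℕ} [∀ s, Fact (q s).Prime] {Y : Fin 2 → Type*} [∀ r, Fintype (Y r)]

/-! ### The law of one block under the encoding of chained blocks -/

section Marginal

variable (M : Model q Y) {n K : ℕ} (c : Layout n)

/-- The chaining indices are disjoint from the information indices, and `link` is a bijection of
`I1` onto `I2`. -/
structure Layout.Sound (c : Layout n) : Prop where
  notMem_of_mem_I1 : ∀ k j, j ∈ c.I1 k → j ∉ c.I k
  notMem_of_mem_I2 : ∀ k j, j ∈ c.I2 k → j ∉ c.I k ∧ j ∉ c.I1 k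
  link_image : ∀ k, c.link k '' c.I1 k = c.I2 k

theorem Layout.Sound.link_mem {c : Layout n} (hc : c.Sound) {k : Fin 2} {j : Fin (2 ^ n)}
    (hj : j ∈ c.I1 k) : c.link k j ∈ c.I2 k :=
  hc.link_image k ▸ Set.mem_image_of_mem _ hj

theorem Layout.Sound.link_symm_mem {c : Layout n} (hc : c.Sound) {k : Fin 2} {j : Fin (2 ^ n)}
    (hj : j ∈ c.I2 k) : (c.link k).symm j ∈ c.I1 k := by
  rw [← hc.link_image k] at hj
  obtain ⟨i, hi, rfl⟩ := hj
  simpa using hi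

/-- The indices at which the encoders put uniform symbols. -/
def Layout.unifSet (c : Layout n) : Stream → Set (Fin (2 ^ n))
  | Sum.inl k => c.I k ∪ c.I1 k ∪ c.I2 k ∪ c.F k
  | Sum.inr k => c.Ip k ∪ c.Fp k

/-- The index of the preceding block. -/
abbrev pred (i : Fin K) : Fin K := ⟨i.val - 1, (Nat.sub_le _ _).trans_lt i.isLt⟩

open Classical in
/-- The seed which determines the symbol `j` of the stream `s` in block `i`. -/
noncomputable def seedValue (z : Seeds q n K) (i : Fin K) :
    ∀ (s : Stream), Fin (2 ^ n) → ZMod (q s)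
  | Sum.inl k, j =>
    if j ∈ c.I k then z.msg i (com k) j
    else if j ∈ c.I1 k then
      if i.val + 1 = K then z.last k j else z.msg i (com k) j
    else if j ∈ c.I2 k then
      if i.val = 0 then z.first k j
      else z.msg (pred i) (com k) ((c.link k).symm j)
    else z.frozen (com k) j
  | Sum.inr k, j => if j ∈ c.Ip k then z.msg i (priv k) j else z.frozen (priv k) j

open Classical in
/-- The point mass at the value `v s j`. -/
noncomputable def pointMass (v : ∀ (s : Stream), Fin (2 ^ n) → ZMod (q s)) (s : Stream)
    (j : Fin (2 ^ n)) (a : ZMod (q s)) : ℝ := if a = v s j then 1 else 0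

/-- Translation of the seeds which changes the symbols of block `i` by `w`. -/
def shiftSeeds (i : Fin K) (w : ∀ (s : Stream), Fin (2 ^ n) → ZMod (q s)) :
    Seeds q n K ≃ Seeds q n K :=
  -- Messages of other blocks are moved by `w` at the linked index. In the preceding block these are
  -- the symbols which block `i` repeats on `I2`; in the remaining blocks the shift does not affect
  -- block `i`.
  let m : Fin K → ∀ (s : Stream), Fin (2 ^ n) → ZMod (q s) := fun i' s j =>
    if i' = i then w s j else match s with
      | Sum.inl k => w (com k) (c.link k j)
      | Sum.inr _ => 0
  { toFun z := ⟨fun s j => z.frozen s j + w s j, fun k j => z.last k j + w (com k) j,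
      fun k j => z.first k j + w (com k) j, fun i' s j => z.msg i' s j + m i' s j⟩
    invFun z := ⟨fun s j => z.frozen s j - w s j, fun k j => z.last k j - w (com k) j,
      fun k j => z.first k j - w (com k) j, fun i' s j => z.msg i' s j - m i' s j⟩
    left_inv z := by simp
    right_inv z := by simp }

theorem seedValue_shiftSeeds (i : Fin K) (w : ∀ (s : Stream), Fin (2 ^ n) → ZMod (q s))
    (z : Seeds q n K) :
    seedValue c (shiftSeeds c i w z) i = fun s j => seedValue c z i s j + w s j := by
  funext s j
  cases s with
  | inl k =>
    -- The preceding block is read only when `i` is not the first, and then truncated subtraction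
    -- does give a different block, whose messages move by the linked rule.
    have hp : i.val ≠ 0 → pred i ≠ i := fun h h' => by
      have := congrArg Fin.val h'
      simp only at this
      omega
    simp only [seedValue, shiftSeeds, Equiv.coe_fn_mk]
    split_ifs <;> simp_all
  | inr k =>
    simp only [seedValue, shiftSeeds, Equiv.coe_fn_mk]
    split_ifs <;> simp_all

/-- Each translation permutes the seeds, so the sum may be averaged over all `w`; for fixed seeds
the translated value then runs through every `v` exactly once. -/
theorem sum_seedValue (i : Fin K) (F : (∀ (s : Stream), Fin (2 ^ n) → ZMod (q s)) → ℝ) :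
    1 / (Fintype.card (Seeds q n K) : ℝ) * ∑ z, F (seedValue c z i) =
      1 / (Fintype.card (∀ (s : Stream), Fin (2 ^ n) → ZMod (q s)) : ℝ) * ∑ v, F v := by
  have h1 : ∀ w, ∑ z, F (seedValue c z i) = ∑ z, F (seedValue c z i + w) := fun w => by
    rw [← (shiftSeeds c i w).sum_comp]
    exact Finset.sum_congr rfl fun z _ => by rw [seedValue_shiftSeeds]; rfl
  have h2 : (Fintype.card (∀ (s : Stream), Fin (2 ^ n) → ZMod (q s)) : ℝ) *
      ∑ z, F (seedValue c z i) = (Fintype.card (Seeds q n K) : ℝ) * ∑ v, F v := by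
    have := Finset.sum_congr (s₁ := Finset.univ) rfl fun w _ => h1 w
    rw [Finset.sum_const, Finset.card_univ, nsmul_eq_mul] at this
    rw [this, Finset.sum_comm]
    have h3 : ∀ z, ∑ w, F (seedValue c z i + w) = ∑ w, F w := fun z =>
      Equiv.sum_comp (Equiv.addLeft (seedValue c z i)) F
    simp [h3]
  have : Nonempty (Seeds q n K) := ⟨⟨0, 0, 0, 0⟩⟩
  have h4 : (Fintype.card (Seeds q n K) : ℝ) ≠ 0 := Nat.cast_ne_zero.2 Fintype.card_ne_zero
  have h5 : (Fintype.card (∀ (s : Stream), Fin (2 ^ n) → ZMod (q s)) : ℝ) ≠ 0 :=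
    Nat.cast_ne_zero.2 Fintype.card_ne_zero
  field_simp
  linarith

/-- The law is a product over coordinates, so the average over uniform point masses can be taken
coordinate by coordinate. -/
theorem avg_encLaw (i : Fin K) (V : Stream → Set (Fin (2 ^ n))) (b : Block q Y n) :
    1 / (Fintype.card (Seeds q n K) : ℝ) * ∑ z, encLaw M V (pointMass (seedValue c z i)) b =
      unifLaw M V b := by
  classical
  rw [sum_seedValue c i fun v => encLaw M V (pointMass v) b]
  simp only [unifLaw, encLaw, ← Finset.sum_mul]
  rw [← mul_assoc]
  congr 1
  -- An index outside `V` repeats its kernel `q s` times, so every coordinate yields a factor `q s`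
  -- and the total cancels the cardinality.
  have h1 : ∀ (s : Stream) (j : Fin (2 ^ n)),
      ∑ a, (if j ∈ V s then (if sym s j b = a then 1 else 0) else kern M s j b) =
      q s * (if j ∈ V s then 1 / (q s : ℝ) else kern M s j b) := by
    intro s j
    have := (q_pos (q := q) s).ne'
    split_ifs
    · simp [this]
    · simp [ZMod.card]
  have h2 : ∑ v : ∀ (s : Stream), Fin (2 ^ n) → ZMod (q s),
      ∏ s, ∏ j, (if j ∈ V s then (if sym s j b = v s j then (1 : ℝ) else 0) else kern M s j b) =
      ∏ s, ∏ j, ((q s : ℝ) * if j ∈ V s then 1 / (q s : ℝ) else kern M s j b) := by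
    simp_rw [← h1]
    rw [← Fintype.prod_sum (fun s (v : Fin (2 ^ n) → ZMod (q s)) => ∏ j,
      (if j ∈ V s then (if sym s j b = v j then (1 : ℝ) else 0) else kern M s j b))]
    refine Finset.prod_congr rfl fun s _ => ?_
    rw [Fintype.prod_sum]
  have h3 : (Fintype.card (∀ (s : Stream), Fin (2 ^ n) → ZMod (q s)) : ℝ) =
      ∏ s : Stream, ∏ _j : Fin (2 ^ n), (q s : ℝ) := by
    simp [Fintype.card_pi, ZMod.card]
  simp only [Finset.prod_mul_distrib] at h2
  rw [← h3] at h2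
  simp only [pointMass]
  rw [h2, ← mul_assoc, one_div_mul_cancel, one_mul]
  exact Nat.cast_ne_zero.2 Fintype.card_ne_zero

/-! ### Support and factorization of the transmission law. -/

variable {M c}

theorem runLaw_ne_zero {ω : Run q Y n K} (hω : runLaw M c ω ≠ 0) {i : Fin K} {k : Fin 2}
    {j : Fin (2 ^ n)} {v : ZMod (q (com k))} (hv : comValue c ω.1 ω.2.1 i k j = some v) :
    ω.2.1 i (com k) j = v := by
  rw [runLaw] at hω
  have h1 := Finset.prod_ne_zero_iff.1 (right_ne_zero_of_mul hω) i (Finset.mem_univ i)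
  have h2 := Finset.prod_ne_zero_iff.1 (left_ne_zero_of_mul h1) k (Finset.mem_univ k)
  have h3 := Finset.prod_ne_zero_iff.1 (left_ne_zero_of_mul h2) j (Finset.mem_univ j)
  rw [comFactor, hv] at h3
  by_contra h
  exact h3 (if_neg h)

theorem encLaw_ne_zero {V : Stream → Set (Fin (2 ^ n))}
    {v : ∀ (s : Stream), Fin (2 ^ n) → ZMod (q s)} {b : Block q Y n}
    (hb : encLaw M V (pointMass v) b ≠ 0) {s : Stream} {j : Fin (2 ^ n)} (hj : j ∈ V s) :
    sym s j b = v s j := by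
  rw [encLaw] at hb
  have h1 := Finset.prod_ne_zero_iff.1 (left_ne_zero_of_mul hb) s (Finset.mem_univ s)
  have h2 := Finset.prod_ne_zero_iff.1 h1 j (Finset.mem_univ j)
  rw [if_pos hj, pointMass] at h2
  by_contra h
  exact h2 (if_neg h)

/-- The encoder copies `I2` symbols from the preceding word, `seedValue` from the message behind it.
The two agree if the words carry their messages on `I1`; otherwise both sides vanish. In this form
the seeds are the only link between blocks. -/
theorem runLaw_eq (hc : c.Sound) (z : Seeds q n K) (u : Words q n K) (y : Outs Y n K) :
    runLaw M c (z, u, y) = 1 / (Fintype.card (Seeds q n K) : ℝ) *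
      ∏ i, encLaw M c.unifSet (pointMass (seedValue c z i)) (toBlock n (u i, y i)) := by
  classical
  by_cases hcons : ∀ (i : Fin K) k j, j ∈ c.I1 k → i.val + 1 ≠ K →
      u i (com k) j = z.msg i (com k) j
  · rw [runLaw]
    congr 1
    refine Finset.prod_congr rfl fun i _ => ?_
    rw [encLaw, Fintype.prod_sum_type, ← Finset.prod_mul_distrib]
    congr 1
    refine Finset.prod_congr rfl fun k _ => ?_
    congr 1
    · refine Finset.prod_congr rfl fun j _ => ?_
      simp only [comFactor, comValue, Layout.unifSet, Set.mem_union, pointMass, seedValue,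
        kern, sym_toBlock, past_toBlock]
      by_cases h1 : j ∈ c.I k
      · simp [h1]
      by_cases h2 : j ∈ c.I1 k
      · by_cases h : i.val + 1 = K <;> simp [h1, h2, h]
      by_cases h3 : j ∈ c.I2 k
      · by_cases h : i.val = 0
        · simp [h1, h2, h3, h]
        -- The preceding block is not the last one, so its `I1` symbol is a message and not a shared
        -- symbol.
        · have := hcons (pred i) k _ (hc.link_symm_mem h3) (by
            have := i.isLt
            simp only
            omega)
          simp [h1, h2, h3, h, this]
      by_cases h4 : j ∈ c.F k <;> simp [h1, h2, h3, h4]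
    · refine Finset.prod_congr rfl fun j _ => ?_
      simp only [privFactor, privValue, Layout.unifSet, Set.mem_union, pointMass, seedValue,
        kern, sym_toBlock, past_toBlock, whole_toBlock]
      by_cases h1 : j ∈ c.Ip k
      · simp [h1]
      by_cases h2 : j ∈ c.Fp k <;> simp [h1, h2]
  · have hl : runLaw M c (z, u, y) = 0 := by
      by_contra h
      refine hcons fun i k j hj hi => runLaw_ne_zero h ?_
      simp [comValue, hc.notMem_of_mem_I1 k j hj, hj, hi]
    have hr : ∏ i, encLaw M c.unifSet (pointMass (seedValue c z i)) (toBlock n (u i, y i)) = 0 := by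
      by_contra h
      refine hcons fun i k j hj hi => ?_
      have := encLaw_ne_zero (Finset.prod_ne_zero_iff.1 h i (Finset.mem_univ i))
        (s := com k) (j := j) (by simp [Layout.unifSet, hj])
      simpa [seedValue, hc.notMem_of_mem_I1 k j hj, hj, hi] using this
    rw [hl, hr, mul_zero]

theorem pointMass_nonneg (v : ∀ (s : Stream), Fin (2 ^ n) → ZMod (q s)) (s : Stream)
    (j : Fin (2 ^ n)) (a : ZMod (q s)) : 0 ≤ pointMass v s j a := by
  unfold pointMass
  split_ifs <;> simp

theorem sum_pointMass (v : ∀ (s : Stream), Fin (2 ^ n) → ZMod (q s)) (s : Stream)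
    (j : Fin (2 ^ n)) : ∑ a, pointMass v s j a = 1 := by
  simp [pointMass]

theorem runLaw_nonneg (hc : c.Sound) (ω : Run q Y n K) : 0 ≤ runLaw M c ω := by
  rw [runLaw_eq hc]
  exact mul_nonneg (by positivity)
    (Finset.prod_nonneg fun i _ => encLaw_nonneg M _ (pointMass_nonneg _) _)

/-- Sequences and outputs of several blocks as a sequence of blocks of letters. -/
noncomputable def toBlocks (n K : ℕ) : Words q n K × Outs Y n K ≃ (Fin K → Block q Y n) :=
  (Equiv.arrowProdEquivProdArrow _ _ _).symm.trans (Equiv.arrowCongr (Equiv.refl _) (toBlock n))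

theorem sum_blocks {B : Type*} [Fintype B] (f : Fin K → B → ℝ) (hf : ∀ i, ∑ b, f i b = 1)
    (i : Fin K) (E : B → Prop) :
    prob (fun b : Fin K → B => ∏ i', f i' (b i')) (fun b => E (b i)) = prob (f i) E := by
  classical
  have h := Fintype.prod_sum (fun i' b => if i' = i then (if E b then f i' b else 0) else f i' b)
  rw [Finset.prod_eq_single i (fun i' _ h => by simp [h, hf]) (by simp)] at h
  simp only [if_true] at h
  unfold prob
  refine Eq.trans ?_ (h.symm.trans ?_)
  · refine Finset.sum_congr rfl fun b _ => ?_
    split_ifs with hE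
    · refine Finset.prod_congr rfl fun i' _ => ?_
      split_ifs with h1 h2
      · rfl
      · subst h1
        exact absurd hE h2
      · rfl
    · exact (Finset.prod_eq_zero (Finset.mem_univ i) (by simp [hE])).symm
  · exact Finset.sum_congr rfl fun b _ => by congr

/-- Every block of the transmission has the law of a block with uniform symbols at the indices
used by the encoders. -/
theorem prob_runLaw_block (hc : c.Sound) (i : Fin K) (E : Block q Y n → Prop) :
    prob (runLaw M (K := K) c) (fun ω => E (toBlock n (ω.2.1 i, ω.2.2 i))) =
      prob (unifLaw M c.unifSet) E := by
  classical
  -- For fixed seeds the other blocks integrate out; the average over the seeds is taken afterwards.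
  have h1 : prob (runLaw M (K := K) c) (fun ω => E (toBlock n (ω.2.1 i, ω.2.2 i))) =
      ∑ z, 1 / (Fintype.card (Seeds q n K) : ℝ) *
        prob (encLaw M c.unifSet (pointMass (seedValue c z i))) E := by
    conv_lhs => unfold prob
    rw [Fintype.sum_prod_type]
    refine Finset.sum_congr rfl fun z _ => ?_
    rw [← sum_blocks (fun i => encLaw M c.unifSet (pointMass (seedValue c z i)))
      (fun i => sum_encLaw M _ (sum_pointMass _)) i E]
    unfold prob
    rw [← (toBlocks n K).sum_comp, Finset.mul_sum]
    refine Finset.sum_congr rfl fun p _ => ?_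
    rw [runLaw_eq hc]
    rw [mul_ite, mul_zero]
    rfl
  rw [h1]
  unfold prob
  simp_rw [Finset.mul_sum]
  rw [Finset.sum_comm]
  refine Finset.sum_congr rfl fun b _ => ?_
  split_ifs
  · rw [← avg_encLaw M c i, Finset.mul_sum]
  · simp

end Marginal

end PolarIC

namespace PolarIC
variable {q : Stream → ℕ} [∀ s, Fact (q s).Prime] {Y : Fin 2 → Type*} [∀ r, Fintype (Y r)]

/-! ### Successive decoding with correct side information -/

theorem successive_eq {ι : Type*} {A : ι → Type*} {ord : ι → ℕ}
    {rule : ∀ i, (∀ i', ord i' < ord i → A i') → A i} {v : ∀ i, A i}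
    (h : ∀ i, rule i (fun i' _ => v i') = v i) (i : ι) : successive ord rule i = v i := by
  induction hm : ord i using Nat.strong_induction_on generalizing i with
  | _ m ih =>
    rw [successive, ← h i]
    congr 1
    funext i' hi'
    exact ih _ (hm ▸ hi') i' rfl

/-- A block decoder need only be right when the preceding result, if there is one, is right. The
value `none` makes this premise vacuous and so covers the start. -/
theorem forward_eq {K : ℕ} {Est : Type*} {blk : Fin K → Option Est → Est} {v : Fin K → Est}
    (h : ∀ i prev, (∀ e, prev = some e → i.val ≠ 0 ∧ e = v (pred i)) → blk i prev = v i)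
    (i : Fin K) : forward blk i = v i := by
  refine successive_eq (fun i => h i _ fun e he => ?_) i
  split_ifs at he with h0
  exact ⟨h0, (Option.some.inj he).symm⟩

theorem backward_eq {K : ℕ} {Est : Type*} {blk : Fin K → Option Est → Est} {v : Fin K → Est}
    (h : ∀ i prev, (∀ e, prev = some e → ∃ hi : i.val + 1 < K, e = v ⟨i.val + 1, hi⟩) →
      blk i prev = v i)
    (i : Fin K) : backward blk i = v i := by
  refine successive_eq (fun i => h i _ fun e he => ?_) i
  split_ifs at he with h0
  exact ⟨h0, (Option.some.inj he).symm⟩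

theorem Expansion.past_toBlock {n : ℕ} (E : Expansion n) (st : Fin 2 → Stream)
    (d : Fin 2 × Fin (2 ^ n)) (u : ∀ s, Fin (2 ^ n) → ZMod (q s))
    (y : Fin (2 ^ n) → ∀ r, Y r) : E.past st d (toBlock n (u, y)) =
      fun d' : {d' // E.pos d' < E.pos d} => u (st d'.1.1) d'.1.2 :=
  funext fun _ => sym_toBlock u y _ _

section Decoding

variable {M : Model q Y} {n K : ℕ} {c : Layout n} {β : ℝ}

/-- On the support of `runLaw` the encoder forces repeated and shared symbols, so whatever is not
estimated is true as soon as the previous result is. -/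
theorem knownFwd_eq (hc : c.Sound) {ω : Run q Y n K} (hω : runLaw M c ω ≠ 0)
    (L : Set (Fin (2 ^ n))) (i : Fin K) (k : Fin 2)
    {prev : Option (Fin (2 ^ n) → ZMod (q (com k)))}
    (hprev : ∀ e, prev = some e → i.val ≠ 0 ∧ e = ω.2.1 (pred i) (com k)) (j : Fin (2 ^ n)) :
    knownFwd c ω L i k prev j = some (ω.2.1 i (com k) j) ∨
      knownFwd c ω L i k prev j = none ∧ j ∈ L := by
  classical
  unfold knownFwd
  split_ifs with h1 h2 h3
  · left
    obtain ⟨e, he⟩ := Option.isSome_iff_exists.1 h1.2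
    obtain ⟨h0, rfl⟩ := hprev e he
    rw [he, Option.map_some]
    congr 1
    symm
    refine runLaw_ne_zero hω ?_
    have := hc.notMem_of_mem_I2 k j h1.1
    simp [comValue, this.1, this.2, h1.1, h0]
  · left
    congr 1
    symm
    refine runLaw_ne_zero hω ?_
    have := hc.notMem_of_mem_I1 k j h2.1
    simp [comValue, this, h2.1, h2.2]
  · exact Or.inr ⟨rfl, h3⟩
  · exact Or.inl rfl

theorem knownBwd_eq (hc : c.Sound) {ω : Run q Y n K} (hω : runLaw M c ω ≠ 0)
    (L : Set (Fin (2 ^ n))) (i : Fin K) (k : Fin 2)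
    {prev : Option (Fin (2 ^ n) → ZMod (q (com k)))}
    (hprev : ∀ e, prev = some e → ∃ hi : i.val + 1 < K, e = ω.2.1 ⟨i.val + 1, hi⟩ (com k))
    (j : Fin (2 ^ n)) :
    knownBwd c ω L i k prev j = some (ω.2.1 i (com k) j) ∨
      knownBwd c ω L i k prev j = none ∧ j ∈ L := by
  classical
  unfold knownBwd
  split_ifs with h1 h2 h3
  · left
    obtain ⟨e, he⟩ := Option.isSome_iff_exists.1 h1.2
    obtain ⟨hi, rfl⟩ := hprev e he
    rw [he, Option.map_some]
    congr 1
    -- The encoding rule is applied in block `i + 1` at the linked index, where it returns the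
    -- symbol of block `i`.
    refine runLaw_ne_zero hω ?_
    have hj := hc.link_mem h1.1
    have := hc.notMem_of_mem_I2 k _ hj
    simp [comValue, this.1, this.2, hj]
  · left
    congr 1
    symm
    refine runLaw_ne_zero hω ?_
    have := hc.notMem_of_mem_I2 k j h2.1
    simp [comValue, this.1, this.2, h2.1, h2.2]
  · exact Or.inr ⟨rfl, h3⟩
  · exact Or.inl rfl

variable (M β)

/-- Some estimate of `f i`, `i ∈ S`, from the true value of `g i` is wrong. -/
def MapFails {ι : Type*} {A G : ι → Type*} [∀ i, Fintype (A i)] [∀ i, Nonempty (A i)]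
    (S : Set ι) (f : ∀ i, Block q Y n → A i) (g : ∀ i, Block q Y n → G i) (b : Block q Y n) :
    Prop :=
  ∃ i, i ∈ S ∧ mapEst (M.target n) (f i) (g i) (g i b) ≠ f i b

theorem prob_mapFails_le {ι : Type*} [Fintype ι] {A G : ι → Type*} [∀ i, Fintype (A i)]
    [∀ i, Nonempty (A i)] [∀ i, Finite (G i)] (S : Set ι) (f : ∀ i, Block q Y n → A i)
    (g : ∀ i, Block q Y n → G i) {δ : ℝ} (hδ : 0 ≤ δ)
    (h : ∀ i ∈ S, condEnt (M.target n) (f i) (g i) ≤ δ) :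
    prob (M.target n) (MapFails M S f g) ≤ Fintype.card ι * δ := by
  refine (prob_exists_le (target_nonneg M) _).trans ?_
  rw [← nsmul_eq_mul, ← Finset.card_univ, ← Finset.sum_const]
  refine Finset.sum_le_sum fun i _ => ?_
  by_cases hi : i ∈ S
  · exact (prob_mono (target_nonneg M) fun _ _ h => h.2).trans
      ((prob_mapEst_ne_le_condEnt (target_nonneg M) (f i) (g i)).trans (h i hi))
  · refine le_of_eq_of_le ?_ hδ
    simp [prob, hi]

/-- Some symbol which a Type I receiver estimates is not the most likely one given the true
previous ones. -/
def FailsI (E : Expansion n) (r : Fin 2) (b : Block q Y n) : Prop :=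
  MapFails M {d : Fin 2 × Fin (2 ^ n) | d.2 ∈ lowS M n β E com r d.1}
    (fun d => sym (com d.1) d.2) (fun d b => (out r b, E.past com d b)) b ∨
  MapFails M (lowXWW M n β r) (fun j => sym (priv r) j)
    (fun j b => (out r b, fun l : Fin 2 => whole (com l) b, past (priv r) j b)) b

/-- Some symbol which a Type II receiver estimates is not the most likely one given the true
previous ones. -/
def FailsII (E : Expansion n) (a : Fin 2) (b : Block q Y n) : Prop :=
  MapFails M (lowW M n β a) (fun j => sym (com a) j) (fun j b => (out a b, past (com a) j b)) b ∨
  MapFails M (lowSW M n β E a) (fun j => sym (priv a) j)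
    (fun j b => (out a b, whole (com a) b, E.past (pairII a) (0, j) b)) b ∨
  MapFails M (lowS M n β E (pairII a) a 1) (fun j => sym (com (other a)) j)
    (fun j b => (out a b, E.past (pairII a) (1, j) b)) b

theorem delta_nonneg : 0 ≤ delta n β := Real.rpow_nonneg zero_le_two _

theorem prob_failsI_le (E : Expansion n) (r : Fin 2) :
    prob (M.target n) (FailsI M β E r) ≤ 3 * ((2 ^ n : ℕ) * delta n β) := by
  have h1 := prob_mapFails_le M {d : Fin 2 × Fin (2 ^ n) | d.2 ∈ lowS M n β E com r d.1}
    (fun d => sym (com d.1) d.2) (fun d b => (out r b, E.past com d b)) (delta_nonneg β)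
    (fun d hd => hd)
  have h2 := prob_mapFails_le M (lowXWW M n β r) (fun j => sym (priv r) j)
    (fun j b => (out r b, fun l : Fin 2 => whole (com l) b, past (priv r) j b)) (delta_nonneg β)
    (fun d hd => hd)
  refine (prob_or_le (target_nonneg M) _ _).trans ((add_le_add h1 h2).trans_eq ?_)
  simp only [Fintype.card_prod, Fintype.card_fin]
  push_cast
  ring

theorem prob_failsII_le (E : Expansion n) (a : Fin 2) :
    prob (M.target n) (FailsII M β E a) ≤ 3 * ((2 ^ n : ℕ) * delta n β) := by
  have h1 := prob_mapFails_le M (lowW M n β a) (fun j => sym (com a) j)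
    (fun j b => (out a b, past (com a) j b)) (delta_nonneg β) (fun d hd => hd)
  have h2 := prob_mapFails_le M (lowSW M n β E a) (fun j => sym (priv a) j)
    (fun j b => (out a b, whole (com a) b, E.past (pairII a) (0, j) b)) (delta_nonneg β)
    (fun d hd => hd)
  have h3 := prob_mapFails_le M (lowS M n β E (pairII a) a 1) (fun j => sym (com (other a)) j)
    (fun j b => (out a b, E.past (pairII a) (1, j) b)) (delta_nonneg β) (fun d hd => hd)
  refine (prob_or_le (target_nonneg M) _ _).trans
    ((add_le_add h1 ((prob_or_le (target_nonneg M) _ _).trans (add_le_add h2 h3))).trans_eq ?_)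
  simp only [Fintype.card_fin]
  push_cast
  ring

variable {M β}

/-! ### Correctness of the decoders when no block is bad. -/

theorem blockI_eq {E : Expansion n} {r : Fin 2} {ω : Run q Y n K} {i : Fin K}
    {known : ∀ k, Fin (2 ^ n) → Option (ZMod (q (com k)))}
    (hk : ∀ k j, known k j = some (ω.2.1 i (com k) j) ∨
      known k j = none ∧ j ∈ lowS M n β E com r k)
    (hb : ¬FailsI M β E r (toBlock n (ω.2.1 i, ω.2.2 i))) :
    blockI M β E r ω i known = (fun k => ω.2.1 i (com k), ω.2.1 i (priv r)) := by
  classical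
  simp only [FailsI, MapFails, not_or, not_exists, not_and, not_not] at hb
  obtain ⟨hb1, hb2⟩ := hb
  have hw : ∀ d, commonI M E r (fun t => ω.2.2 i t r) known d = ω.2.1 i (com d.1) d.2 := by
    refine successive_eq fun d => ?_
    rcases hk d.1 d.2 with h | ⟨h, hl⟩
    · rw [h]; rfl
    · rw [h]
      have := hb1 d hl
      rw [sym_toBlock, out_toBlock] at this
      refine Eq.trans ?_ this
      rw [Expansion.past_toBlock]
      rfl
  have hw' : (fun k j => commonI M E r (fun t => ω.2.2 i t r) known (k, j)) =
      fun k => ω.2.1 i (com k) := funext fun k => funext fun j => hw (k, j)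
  refine Prod.ext hw' ?_
  simp only [blockI]
  rw [hw']
  refine funext (successive_eq fun j => ?_)
  split_ifs with hl
  · have := hb2 j hl
    rw [sym_toBlock, out_toBlock, past_toBlock] at this
    simp only [whole_toBlock] at this
    exact this
  · rfl

theorem decodeIFwd_eq (hc : c.Sound) {E : Expansion n} {r : Fin 2} {ω : Run q Y n K}
    (hω : runLaw M c ω ≠ 0) (hb : ∀ i, ¬FailsI M β E r (toBlock n (ω.2.1 i, ω.2.2 i)))
    (i : Fin K) :
    decodeIFwd M c β E r ω i = (fun k => ω.2.1 i (com k), ω.2.1 i (priv r)) := by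
  refine forward_eq (v := fun i => ((fun k => ω.2.1 i (com k), ω.2.1 i (priv r)) : EstI q n r))
    (fun i prev hprev => blockI_eq (fun k j => ?_) (hb i)) i
  refine knownFwd_eq hc hω _ i k (fun e he => ?_) j
  obtain ⟨e', he', rfl⟩ := Option.map_eq_some_iff.1 he
  obtain ⟨h0, rfl⟩ := hprev e' he'
  exact ⟨h0, rfl⟩

theorem decodeIBwd_eq (hc : c.Sound) {E : Expansion n} {r : Fin 2} {ω : Run q Y n K}
    (hω : runLaw M c ω ≠ 0) (hb : ∀ i, ¬FailsI M β E r (toBlock n (ω.2.1 i, ω.2.2 i)))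
    (i : Fin K) :
    decodeIBwd M c β E r ω i = (fun k => ω.2.1 i (com k), ω.2.1 i (priv r)) := by
  refine backward_eq (v := fun i => ((fun k => ω.2.1 i (com k), ω.2.1 i (priv r)) : EstI q n r))
    (fun i prev hprev => blockI_eq (fun k j => ?_) (hb i)) i
  refine knownBwd_eq hc hω _ i k (fun e he => ?_) j
  obtain ⟨e', he', rfl⟩ := Option.map_eq_some_iff.1 he
  obtain ⟨h0, rfl⟩ := hprev e' he'
  exact ⟨h0, rfl⟩

theorem commonII_eq {E : Expansion n} {a : Fin 2} {ω : Run q Y n K} {i : Fin K}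
    {known : Fin (2 ^ n) → Option (ZMod (q (com a)))}
    (hk : ∀ j, known j = some (ω.2.1 i (com a) j) ∨ known j = none ∧ j ∈ lowW M n β a)
    (hb : ¬FailsII M β E a (toBlock n (ω.2.1 i, ω.2.2 i))) :
    commonII M a (fun t => ω.2.2 i t a) known = ω.2.1 i (com a) := by
  simp only [FailsII, MapFails, not_or, not_exists, not_and, not_not] at hb
  refine funext (successive_eq fun j => ?_)
  rcases hk j with h | ⟨h, hl⟩
  · rw [h]; rfl
  · rw [h]
    have := hb.1 j hl
    rw [sym_toBlock, out_toBlock, past_toBlock] at this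
    exact this

theorem jointII_eq {E : Expansion n} {a : Fin 2} {ω : Run q Y n K} {i : Fin K}
    {known : Fin (2 ^ n) → Option (ZMod (q (com (other a))))}
    (hk : ∀ j, known j = some (ω.2.1 i (com (other a)) j) ∨
      known j = none ∧ j ∈ lowS M n β E (pairII a) a 1)
    (hb : ¬FailsII M β E a (toBlock n (ω.2.1 i, ω.2.2 i))) :
    jointII M β E a (fun t => ω.2.2 i t a) (ω.2.1 i (com a)) (ω.2.1 i (priv a)) known =
      fun d : Fin 2 × Fin (2 ^ n) => ω.2.1 i (pairII a d.1) d.2 := by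
  classical
  simp only [FailsII, MapFails, not_or, not_exists, not_and, not_not] at hb
  obtain ⟨-, hb1, hb2⟩ := hb
  refine funext (successive_eq fun d => ?_)
  match d with
  | (0, j) =>
    dsimp only
    split_ifs with hl
    · have := hb1 j hl
      rw [sym_toBlock, out_toBlock, whole_toBlock, Expansion.past_toBlock] at this
      exact this
    · rfl
  | (1, j) =>
    dsimp only
    rcases hk j with h | ⟨h, hl⟩
    · rw [h]; rfl
    · rw [h]
      have := hb2 j hl
      rw [sym_toBlock, out_toBlock, Expansion.past_toBlock] at this
      exact this

theorem decodeII_eq (hc : c.Sound) {E : Expansion n} {a : Fin 2} {ω : Run q Y n K}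
    (hω : runLaw M c ω ≠ 0) (hb : ∀ i, ¬FailsII M β E a (toBlock n (ω.2.1 i, ω.2.2 i)))
    (i : Fin K) :
    decodeII M c β E a ω i =
      (ω.2.1 i (com a), fun d : Fin 2 × Fin (2 ^ n) => ω.2.1 i (pairII a d.1) d.2) := by
  refine forward_eq (v := fun i => ((ω.2.1 i (com a),
    fun d : Fin 2 × Fin (2 ^ n) => ω.2.1 i (pairII a d.1) d.2) : EstII q n a))
    (fun i prev hprev => ?_) i
  have h1 : commonII M a (fun t => ω.2.2 i t a)
      (knownFwd c ω (lowW M n β a) i a (prev.map fun e => e.1)) = ω.2.1 i (com a) := by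
    refine commonII_eq (fun j => knownFwd_eq hc hω _ i a (fun e he => ?_) j) (hb i)
    obtain ⟨e', he', rfl⟩ := Option.map_eq_some_iff.1 he
    obtain ⟨h0, rfl⟩ := hprev e' he'
    exact ⟨h0, rfl⟩
  refine Prod.ext h1 ?_
  dsimp only
  rw [h1]
  refine jointII_eq (fun j => knownFwd_eq hc hω _ i (other a) (fun e he => ?_) j) (hb i)
  obtain ⟨e', he', rfl⟩ := Option.map_eq_some_iff.1 he
  obtain ⟨h0, rfl⟩ := hprev e' he'
  exact ⟨h0, rfl⟩

/-! ### Error probabilities -/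

/-- The symbols which the encoders make uniform are nearly uniform under the target law. -/
def Layout.High (M : Model q Y) (β : ℝ) (c : Layout n) : Prop :=
  ∀ k, c.I k ∪ c.I1 k ∪ c.I2 k ∪ c.F k ⊆ highW M n β k ∧ c.Ip k ∪ c.Fp k ⊆ highX M n β k

/-- Union bound over the blocks. -/
theorem prob_error_le (hc : c.Sound) (hh : c.High M β) {Err : Run q Y n K → Prop}
    {Fails : Block q Y n → Prop}
    (herr : ∀ ω, runLaw M c ω ≠ 0 → Err ω → ∃ i, Fails (toBlock n (ω.2.1 i, ω.2.2 i)))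
    (hf : prob (M.target n) Fails ≤ 3 * ((2 ^ n : ℕ) * delta n β)) :
    prob (runLaw M (K := K) c) Err ≤ K * (3 * ((2 ^ n : ℕ) * delta n β) +
      2 * (√(Real.log 2) * √((2 ^ n : ℕ) * delta n β))) := by
  refine (prob_mono (runLaw_nonneg hc) herr).trans
    ((prob_exists_le (runLaw_nonneg hc) _).trans ?_)
  -- From here on only the marginal law of each block matters.
  simp_rw [prob_runLaw_block hc]
  rw [Finset.sum_const, Finset.card_univ, Fintype.card_fin, nsmul_eq_mul]
  refine mul_le_mul_of_nonneg_left ?_ (Nat.cast_nonneg K)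
  refine (prob_unifLaw_le M c.unifSet (delta_nonneg β) (fun s j hj => ?_) Fails).trans
    (add_le_add_left hf _)
  cases s with
  | inl k => exact (hh k).1 hj
  | inr k => exact (hh k).2 hj

/-- The total mass is read off from the marginal of the first block. The trivial bound is needed in
`boundII`. -/
theorem prob_runLaw_le_one (hc : c.Sound) (hK : 1 ≤ K) (E : Run q Y n K → Prop) :
    prob (runLaw M (K := K) c) E ≤ 1 := by
  refine prob_le_one (runLaw_nonneg hc) (le_of_eq ?_) E
  have h := prob_runLaw_block (M := M) (K := K) hc ⟨0, hK⟩ fun _ => True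
  simp only [prob, if_true] at h
  exact h.trans (sum_encLaw M c.unifSet fun s _ => sum_unif s)

/-! ### The layouts of both schemes are sound and high. -/

theorem highS_com_subset (E : Expansion n) (k : Fin 2) :
    highS M n β E com k ⊆ highW M n β k := fun j hj =>
  -- The index sets condition on the whole expansion, the encoder only on the sequence's own past.
  -- As the expansion keeps the order, the latter is a function of the former, and conditioning on
  -- less only raises the entropy.
  le_trans hj (condEnt_le_condEnt_comp (target_nonneg M) (sym (com k) j) (E.past com (k, j))
    (fun h (i : {i // i < j}) => h ⟨(k, i.1), E.mono k i.2⟩))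

theorem highXWW_subset (k : Fin 2) : highXWW M n β k ⊆ highX M n β k := fun j hj =>
  le_trans hj (condEnt_le_condEnt_comp (target_nonneg M) (sym (priv k) j)
    (fun b => (fun l : Fin 2 => whole (com l) b, past (priv k) j b)) (fun p => (p.1 k, p.2)))

theorem SchemeA.sound (A : SchemeA M n β) : A.layout.Sound where
  notMem_of_mem_I1 _ _ h h' := h.2 h'.2
  notMem_of_mem_I2 k _ h := ⟨fun h' => (A.sel_subset k h).2 h'.1,
    fun h' => (A.sel_subset k h).2 h'.1⟩
  link_image := A.link_image

theorem SchemeA.high (A : SchemeA M n β) : A.layout.High M β := by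
  refine fun k => ⟨?_, ?_⟩
  · rintro j (((h | h) | h) | h)
    · exact highS_com_subset _ k h.1.1
    · exact highS_com_subset _ k h.1.1
    · exact highS_com_subset _ k (A.sel_subset k h).1.1
    · exact h.1
  · rintro j (h | h) <;> exact highXWW_subset k h.1

theorem SchemeB.sound (B : SchemeB M n β) : B.layout.Sound where
  notMem_of_mem_I1 _ _ h h' := h.2 h'.2
  notMem_of_mem_I2 _ _ h := ⟨fun h' => h.2 h'.1, fun h' => h.2 h'.1⟩
  link_image := B.link_image

theorem SchemeB.high (B : SchemeB M n β) : B.layout.High M β := by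
  refine fun k => ⟨?_, ?_⟩
  · rintro j (((h | h) | h) | h)
    · exact (B.C1_subset k h.1).1
    · exact (B.C1_subset k h.1).1
    · exact (B.C2_subset k h.1).1
    · exact h.1
  · rintro j (h | h)
    · have h : j ∈ (if k = B.a then highX M n β k ∩ lowSW M n β B.S B.a
        else highXWW M n β k ∩ lowXWW M n β k) := h
      split_ifs at h
      · exact h.1
      · exact highXWW_subset k h.1
    · have h : j ∈ (if k = B.a then highX M n β k ∩ (lowSW M n β B.S B.a)ᶜ
        else highXWW M n β k ∩ (lowXWW M n β k)ᶜ) := h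
      split_ifs at h
      · exact h.1
      · exact highXWW_subset k h.1

theorem SchemeA.errorProb_le (A : SchemeA M n β) (K : ℕ) (r : Fin 2) :
    A.errorProb K r ≤ K * (3 * ((2 ^ n : ℕ) * delta n β) +
      2 * (√(Real.log 2) * √((2 ^ n : ℕ) * delta n β))) := by
  refine prob_error_le A.sound A.high (fun ω hω herr => ?_) (prob_failsI_le M β (A.path r) r)
  by_contra! h
  obtain ⟨i, hi⟩ := herr
  split_ifs at hi
  · exact hi (decodeIFwd_eq A.sound hω h i)
  · exact hi (decodeIBwd_eq A.sound hω h i)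

theorem SchemeB.errorProbI_le (B : SchemeB M n β) (K : ℕ) :
    B.errorProbI K ≤ K * (3 * ((2 ^ n : ℕ) * delta n β) +
      2 * (√(Real.log 2) * √((2 ^ n : ℕ) * delta n β))) := by
  refine prob_error_le B.sound B.high (fun ω hω herr => ?_) (prob_failsI_le M β B.T (other B.a))
  by_contra! h
  obtain ⟨i, hi⟩ := herr
  exact hi (decodeIBwd_eq B.sound hω h i)

theorem SchemeB.errorProbII_le (B : SchemeB M n β) (K : ℕ) :
    B.errorProbII K ≤ K * (3 * ((2 ^ n : ℕ) * delta n β) +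
      2 * (√(Real.log 2) * √((2 ^ n : ℕ) * delta n β))) := by
  refine prob_error_le B.sound B.high (fun ω hω herr => ?_) (prob_failsII_le M β B.S B.a)
  by_contra! h
  obtain ⟨i, hi⟩ := herr
  exact hi (decodeII_eq B.sound hω h i)

end Decoding

/-! ### Comparison of the linear bound with the claimed polynomials in `K`. -/

theorem boundI {K : ℕ} (hK : 1 ≤ K) {x s : ℝ} (hx : 0 ≤ x) (hs : 0 ≤ s) :
    K * (3 * x + 2 * s) ≤ ((K : ℝ) + 1) * (K + 2) / 2 * x + 2 * K * (K + 1) * s := by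
  have hK1 : (1 : ℝ) ≤ K := by exact_mod_cast hK
  -- `(K+1)(K+2)/2 - 3K = (K-1)(K-2)/2` is nonnegative because `K` is an integer, and vanishes at `K
  -- = 1, 2`.
  have h0 : (0 : ℝ) ≤ ((K : ℝ) - 1) * (K - 2) := by
    rcases hK.eq_or_lt with h | h
    · simp [← h]
    · have : (2 : ℝ) ≤ K := by exact_mod_cast h
      nlinarith
  have h1 := mul_nonneg h0 hx
  have h2 : 0 ≤ ((K : ℝ) * K) * s := by positivity
  nlinarith

/-- For `K ≥ 2` both coefficients dominate the linear ones. For `K = 1`, with `s = √(log 2) √x`, the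
target is `2x + 4s` against `3x + 2s`: if `x ≤ 1`, then `x ≤ √x` and `√(log 2) ≥ 1/2` give `x ≤ 2s`;
if `x > 1`, already `2x` exceeds `p ≤ 1`. -/
theorem boundII {K : ℕ} (hK : 1 ≤ K) {x p : ℝ} (hx : 0 ≤ x) (hp : p ≤ 1)
    (h : p ≤ K * (3 * x + 2 * (√(Real.log 2) * √x))) :
    p ≤ (K : ℝ) * (K + 1) * (K + 5) / 6 * x +
      2 * K * ((K : ℝ) ^ 2 + 6 * K - 1) / 3 * √(Real.log 2) * √x := by
  rw [mul_assoc _ (√(Real.log 2))]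
  have hs : 0 ≤ √(Real.log 2) * √x := by positivity
  rcases hK.eq_or_lt with rfl | hK2
  · norm_num at h ⊢
    rcases le_or_gt x 1 with h1 | h1
    · have h2 : 1 / 2 ≤ √(Real.log 2) := by
        refine Real.le_sqrt_of_sq_le ?_
        have := Real.log_two_gt_d9
        norm_num at this ⊢
        linarith
      have h3 : x ≤ √x := Real.le_sqrt_of_sq_le (by nlinarith)
      have := mul_le_mul h2 h3 hx (by positivity)
      linarith
    · linarith
  · have hK2' : (2 : ℝ) ≤ K := by exact_mod_cast hK2
    refine h.trans ?_
    generalize √(Real.log 2) * √x = s at hs ⊢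
    have h1 : 3 * (K : ℝ) ≤ (K : ℝ) * (K + 1) * (K + 5) / 6 := by nlinarith [sq_nonneg (K : ℝ)]
    have h2 : 2 * (K : ℝ) ≤ 2 * K * ((K : ℝ) ^ 2 + 6 * K - 1) / 3 := by
      nlinarith [sq_nonneg (K : ℝ)]
    have := mul_le_mul_of_nonneg_right h1 hx
    have := mul_le_mul_of_nonneg_right h2 hs
    linarith

end PolarIC

theorem lemma4 {q : PolarIC.Stream → ℕ} [∀ s, Fact (q s).Prime]
    {Y : Fin 2 → Type*} [∀ r, Fintype (Y r)] (M : PolarIC.Model q Y)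
    (n K : ℕ) (hK : 1 ≤ K) (β : ℝ) (hβ0 : 0 < β) (hβ1 : β < 1 / 2) :
    (∀ (A : PolarIC.SchemeA M n β) (r : Fin 2),
      A.errorProb K r ≤
        ((K : ℝ) + 1) * (K + 2) / 2 * ((2 ^ n : ℕ) * PolarIC.delta n β) +
          2 * K * (K + 1) * √(Real.log 2) * √((2 ^ n : ℕ) * PolarIC.delta n β)) ∧
    (∀ B : PolarIC.SchemeB M n β,
      B.errorProbI K ≤
        ((K : ℝ) + 1) * (K + 2) / 2 * ((2 ^ n : ℕ) * PolarIC.delta n β) +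
          2 * K * (K + 1) * √(Real.log 2) * √((2 ^ n : ℕ) * PolarIC.delta n β) ∧
      B.errorProbII K ≤
        (K : ℝ) * (K + 1) * (K + 5) / 6 * ((2 ^ n : ℕ) * PolarIC.delta n β) +
          2 * K * ((K : ℝ) ^ 2 + 6 * K - 1) / 3 * √(Real.log 2) *
            √((2 ^ n : ℕ) * PolarIC.delta n β)) := by
  have hx : 0 ≤ ((2 ^ n : ℕ) : ℝ) * PolarIC.delta n β :=
    mul_nonneg (Nat.cast_nonneg _) (PolarIC.delta_nonneg β)
  have hs : 0 ≤ √(Real.log 2) * √(((2 ^ n : ℕ) : ℝ) * PolarIC.delta n β) := by positivity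
  refine ⟨fun A r => ?_, fun B => ⟨?_, ?_⟩⟩
  · rw [mul_assoc _ (√(Real.log 2))]
    exact (A.errorProb_le K r).trans (PolarIC.boundI hK hx hs)
  · rw [mul_assoc _ (√(Real.log 2))]
    exact (B.errorProbI_le K).trans (PolarIC.boundI hK hx hs)
  · exact PolarIC.boundII hK hx (PolarIC.prob_runLaw_le_one B.sound hK _) (B.errorProbII_le K)
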